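/- For a connected embedded complex submanifold $M\subset\mathbb{C}^d$ let $\mathsf{k}_M$ be its Kobayashi distance. A subset $S\subset M$ is a *geodesic subspace* of $M$ if $(S,\mathsf{k}_M|_{S\times S})$ is Cauchy-complete and any two distinct points of $S$ are joined by a geodesic of $(M,\mathsf{k}_M)$ (a map $\gamma$ from an interval with $\mathsf{k}_M(\gamma(s),\gamma(t))=|s-t|$ for all $s,t$) contained in $S$. Closures are taken in $\mathbb{C}^d$. A geodesic subspace $S$ is a *visibility subspace* of $M$ if for all $p\neq q$ in $\overline{S}\setminus S$ there are neighbourhoods $U$ of $p$ and $V$ of $q$ in $\mathbb{C}^d$ with $\overline{U}\cap\overline{V}=\emptyset$ and a compact set $K\subset S$ such that every $\mathsf{k}_M$-geodesic in $S$ with initial point in $U\cap S$ and terminal point in $V\cap S$ meets $K$. A *geodesic loop of $S$ in $\overline{S}$* is a map $\gamma:\mathbb{R}\to S$ with $\mathsf{k}_M(\gamma(s),\gamma(t))=|s-t|$ for all $s,t\in\mathbb{R}$ such that the set of limit points of $\gamma(t)$ in $\overline{S}$ as $t\to\infty$ equals the set of its limit points as $t\to-\infty$. For a complete Gromov hyperbolic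 $(M,\mathsf{k}_M)$ and a base point $o\in M$, the *Gromov compactification* $\overline{M}^G$ is the union of $M$ and the Gromov boundary, i.e. the set of equivalence classes of geodesic rays from $o$, two rays $\gamma,\eta$ being equivalent if $\sup_{t\ge 0}\mathsf{k}_M(\gamma(t),\eta(t))<\infty$. A sequence $(\xi_\nu)$ in $\overline{M}^G$ converges to $\xi$ if there are generalized rays $c_\nu$ from $o$ to $\xi_\nu$ (geodesic rays in the class $\xi_\nu$ if $\xi_\nu$ is a boundary point; geodesic segments from $o$ to $\xi_\nu$, continued as constants, if $\xi_\nu\in M$) such that every subsequence of $(c_\nu)$ has a further subsequence that converges, uniformly on compact subsets of $[0,\infty)$, to a generalized ray from $o$ to $\xi$. The closed subsets of $\overline{M}^G$ are those that are closed under this convergence. **Theorem.** Let $M\subset\mathbb{C}^m$ and $N\subset\mathbb{C}^n$ be bounded, connected, embedded complex submanifolds such that $(M,\mathsf{k}_M)$ is complete and Gromov hyperbolic. Let $f:M\to N$ be an isometry with respect to the Kobayashi distances, i.e. $\mathsf{k}_N(f(x),f(y))=\mathsf{k}_M(x,y)$ for all $x,y\in M$, and let $S:=f(M)$. Then $S$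 is a geodesic subspace of $N$. Suppose moreover that $S$ is a visibility subspace of $N$. Then, for every choice of the base point $o$, $f$ extends to a continuous map $\widehat{f}:\overline{M}^G\to\overline{N}$. Further, if $S$ has no geodesic loops in $\overline{S}$, then $\widehat{f}$ is a homeomorphism from $\overline{M}^G$ onto $\overline{S}$. -/

import Mathlib

open Set Filter Topology
open scoped NNReal ENNReal

noncomputable section

/-! ## Bounded connected embedded complex submanifolds of `ℂᵈ` -/

/-- `ℂᵈ` with its Euclidean norm. -/
abbrev CSpace (d : ℕ) : Type := EuclideanSpace ℂ (Fin d)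

/-- `M ⊆ ℂᵈ` is an embedded complex submanifold: near each of its points there is a biholomorphic
change of coordinates of the ambient space that takes `M` to (an open piece of) a complex linear
subspace. -/
def IsEmbeddedComplexSubmanifold {d : ℕ} (M : Set (CSpace d)) : Prop :=
  ∀ p ∈ M, ∃ φ : OpenPartialHomeomorph (CSpace d) (CSpace d),
    p ∈ φ.source ∧ DifferentiableOn ℂ φ φ.source ∧ DifferentiableOn ℂ φ.symm φ.target ∧
      ∃ L : Submodule ℂ (CSpace d), φ '' (M ∩ φ.source) = (L : Set (CSpace d)) ∩ φ.target

/-- Bounded, connected (in particular non-empty), embedded complex submanifolds of `ℂᵈ`. -/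
structure IsBddConnSubmanifold {d : ℕ} (M : Set (CSpace d)) : Prop where
  embedded : IsEmbeddedComplexSubmanifold M
  connected : IsConnected M
  bounded : Bornology.IsBounded M

/-! ## The Kobayashi distance -/

/-- The Poincaré distance of the unit disc, `artanh |(a - b) / (1 - ā b)|`. -/
def poincareDist (a b : ℂ) : ℝ :=
  Real.artanh ‖(a - b) / (1 - (starRingEnd ℂ) a * b)‖

/-- Holomorphic maps from the open unit disc into `M` (holomorphy into an embedded submanifold is
holomorphy as a map into the ambient space). -/
def IsHolomorphicDisc {d : ℕ} (M : Set (CSpace d)) (φ : ℂ → CSpace d) : Prop :=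
  DifferentiableOn ℂ φ (Metric.ball 0 1) ∧ MapsTo φ (Metric.ball 0 1) M

/-- `KobayashiChain M z w r`: there is a finite chain of holomorphic discs in `M` from `z` to `w`
of total Poincaré length `r`. -/
inductive KobayashiChain {d : ℕ} (M : Set (CSpace d)) (z : CSpace d) : CSpace d → ℝ≥0∞ → Prop
  | refl (hz : z ∈ M) : KobayashiChain M z z 0
  | snoc (r : ℝ≥0∞) (φ : ℂ → CSpace d) (hφ : IsHolomorphicDisc M φ) (a b : ℂ)
      (ha : a ∈ Metric.ball (0 : ℂ) 1) (hb : b ∈ Metric.ball (0 : ℂ) 1)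
      (h : KobayashiChain M z (φ a) r) :
      KobayashiChain M z (φ b) (r + ENNReal.ofReal (poincareDist a b))

/-- The Kobayashi (pseudo)distance of `M`: the infimum of the lengths of the chains of holomorphic
discs joining two points. (It is finite when `M` is a connected embedded submanifold.) -/
def kobayashiEDist {d : ℕ} (M : Set (CSpace d)) (z w : CSpace d) : ℝ≥0∞ :=
  sInf {r | KobayashiChain M z w r}

lemma poincareDist_comm (a b : ℂ) : poincareDist a b = poincareDist b a := by
  unfold poincareDist
  rw [norm_div, norm_div, norm_sub_rev a b]
  congr 2
  rw [← RCLike.norm_conj (1 - (starRingEnd ℂ) a * b)]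
  simp [mul_comm]

lemma KobayashiChain.append {d : ℕ} {M : Set (CSpace d)} {x y z : CSpace d} {r s : ℝ≥0∞}
    (h₁ : KobayashiChain M x y r) (h₂ : KobayashiChain M y z s) :
    KobayashiChain M x z (r + s) := by
  induction h₂ with
  | refl _ => simpa using h₁
  | snoc s φ hφ a b ha hb _ ih =>
    rw [← add_assoc]
    exact KobayashiChain.snoc _ φ hφ a b ha hb ih

lemma KobayashiChain.reverse {d : ℕ} {M : Set (CSpace d)} {x y : CSpace d} {r : ℝ≥0∞}
    (h : KobayashiChain M x y r) : KobayashiChain M y x r := by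
  induction h with
  | refl hz => exact KobayashiChain.refl hz
  | snoc s φ hφ a b ha hb _ ih =>
    have h1 : KobayashiChain M (φ b) (φ a) (0 + ENNReal.ofReal (poincareDist b a)) :=
      KobayashiChain.snoc 0 φ hφ b a hb ha (KobayashiChain.refl (hφ.2 hb))
    have h2 := h1.append ih
    rw [zero_add, poincareDist_comm b a, add_comm] at h2
    exact h2

lemma kobayashiEDist_self {d : ℕ} {M : Set (CSpace d)} {z : CSpace d} (hz : z ∈ M) :
    kobayashiEDist M z z = 0 :=
  le_antisymm (sInf_le (KobayashiChain.refl hz)) bot_le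

lemma kobayashiEDist_comm {d : ℕ} (M : Set (CSpace d)) (z w : CSpace d) :
    kobayashiEDist M z w = kobayashiEDist M w z := by
  unfold kobayashiEDist
  congr 1
  ext r
  exact ⟨fun h => h.reverse, fun h => h.reverse⟩

lemma kobayashiEDist_triangle {d : ℕ} (M : Set (CSpace d)) (x y z : CSpace d) :
    kobayashiEDist M x z ≤ kobayashiEDist M x y + kobayashiEDist M y z := by
  unfold kobayashiEDist
  rw [ENNReal.sInf_add]
  refine le_iInf₂ fun r hr => ?_
  rw [add_comm, ENNReal.sInf_add]
  refine le_iInf₂ fun s hs => ?_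
  rw [add_comm]
  exact sInf_le (KobayashiChain.append hr hs)

/-- The space `(M, k_M)`: the points of `M` with the Kobayashi distance (and with the uniformity
and the topology that this distance defines). -/
structure KobayashiSpace {d : ℕ} (M : Set (CSpace d)) where
  /-- the point of `ℂᵈ` -/
  val : CSpace d
  mem : val ∈ M

instance {d : ℕ} (M : Set (CSpace d)) : PseudoEMetricSpace (KobayashiSpace M) where
  edist x y := kobayashiEDist M x.val y.val
  edist_self x := kobayashiEDist_self x.mem
  edist_comm x y := kobayashiEDist_comm M x.val y.val
  edist_triangle x y z := kobayashiEDist_triangle M x.val y.val z.val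

/-! ## Gromov hyperbolicity and the Gromov compactification -/

/-- `γ` restricted to `[0, L]` is a geodesic. -/
def IsGeodesicSegment {X : Type*} [PseudoEMetricSpace X] (γ : ℝ → X) (L : ℝ) : Prop :=
  0 ≤ L ∧ ∀ s ∈ Icc (0 : ℝ) L, ∀ t ∈ Icc (0 : ℝ) L, edist (γ s) (γ t) = edist s t

/-- Gromov hyperbolicity of a geodesic space: for some `δ`, each side of each geodesic triangle
lies in the `δ`-neighbourhood of the union of the other two sides. (A side may be traversed in
either direction and the triangle relabelled, so it is enough to look at one side.) A complete
`(M, k_M)`, to which this is applied, is a geodesic space. -/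
def IsGromovHyperbolic (X : Type*) [PseudoEMetricSpace X] : Prop :=
  ∃ δ : ℝ≥0, ∀ (a b c : ℝ) (α β γ : ℝ → X),
    IsGeodesicSegment α a → IsGeodesicSegment β b → IsGeodesicSegment γ c →
      α 0 = γ 0 → α a = β 0 → β b = γ c →
        ∀ t ∈ Icc (0 : ℝ) a, (∃ s ∈ Icc (0 : ℝ) b, edist (α t) (β s) ≤ δ) ∨
          ∃ s ∈ Icc (0 : ℝ) c, edist (α t) (γ s) ≤ δ

/-- Geodesic rays issuing from `o`. -/
structure GeodesicRay {X : Type*} [PseudoEMetricSpace X] (o : X) where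
  /-- the underlying map `[0, ∞) → X` -/
  toFun : ℝ≥0 → X
  isometry : Isometry toFun
  start : toFun 0 = o

/-- Two rays are equivalent when they stay at bounded distance from each other. -/
def GeodesicRay.setoid {X : Type*} [PseudoEMetricSpace X] (o : X) : Setoid (GeodesicRay o) where
  r γ η := ∃ C : ℝ≥0, ∀ t : ℝ≥0, edist (γ.toFun t) (η.toFun t) ≤ C
  iseqv :=
    { refl := fun γ => ⟨0, fun t => by simp⟩
      symm := fun ⟨C, hC⟩ => ⟨C, fun t => by rw [edist_comm]; exact hC t⟩
      trans := by
        rintro γ η ζ ⟨C, hC⟩ ⟨D, hD⟩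
        refine ⟨C + D, fun t => (edist_triangle _ (η.toFun t) _).trans ?_⟩
        rw [ENNReal.coe_add]
        exact add_le_add (hC t) (hD t) }

/-- The Gromov boundary, with base point `o`: equivalence classes of geodesic rays from `o`. -/
def GromovBoundary {X : Type*} [PseudoEMetricSpace X] (o : X) : Type _ :=
  Quotient (GeodesicRay.setoid o)

/-- The Gromov compactification, with base point `o`: the points of `X` and those of its Gromov
boundary. -/
inductive GromovCompactification {X : Type*} [PseudoEMetricSpace X] (o : X) : Type _
  | point (x : X) : GromovCompactification o
  | ideal (ξ : GromovBoundary o) : GromovCompactification o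

/-- `IsGeneralizedRay o c ξ`: the map `c : [0, ∞) → X` is a generalized ray from `o` to `ξ`, i.e.
either a geodesic segment from `o` to a point `x` of `X`, continued as the constant `x`, or a
geodesic ray from `o` in the class `ξ`. -/
def IsGeneralizedRay {X : Type*} [PseudoEMetricSpace X] (o : X) (c : ℝ≥0 → X) :
    GromovCompactification o → Prop
  | .point x => ∃ R : ℝ≥0, c 0 = o ∧ (∀ s ≤ R, ∀ t ≤ R, edist (c s) (c t) = edist s t) ∧
      ∀ t, R ≤ t → c t = x
  | .ideal ξ => ∃ γ : GeodesicRay o, γ.toFun = c ∧ Quotient.mk (GeodesicRay.setoid o) γ = ξ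

/-- Convergence of sequences in the Gromov compactification: there are generalized rays `c n` from
`o` to `u n` such that each subsequence has a further subsequence that converges, uniformly on
compact sets, to a generalized ray from `o` to `ξ`. -/
def GromovConverges {X : Type*} [PseudoEMetricSpace X] (o : X)
    (u : ℕ → GromovCompactification o) (ξ : GromovCompactification o) : Prop :=
  ∃ c : ℕ → ℝ≥0 → X, (∀ n, IsGeneralizedRay o (c n) (u n)) ∧
    ∀ τ : ℕ → ℕ, StrictMono τ → ∃ θ : ℕ → ℕ, StrictMono θ ∧
      ∃ c' : ℝ≥0 → X, IsGeneralizedRay o c' ξ ∧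
        ∀ K : Set ℝ≥0, IsCompact K → TendstoUniformlyOn (fun n => c (τ (θ n))) c' atTop K

lemma GromovConverges.comp {X : Type*} [PseudoEMetricSpace X] {o : X}
    {u : ℕ → GromovCompactification o} {ξ : GromovCompactification o}
    (h : GromovConverges o u ξ) {σ : ℕ → ℕ} (hσ : StrictMono σ) :
    GromovConverges o (u ∘ σ) ξ := by
  obtain ⟨c, hc, hs⟩ := h
  exact ⟨c ∘ σ, fun n => hc (σ n), fun τ hτ => hs (σ ∘ τ) (hσ.comp hτ)⟩

/-- The Gromov topology: closed sets are those closed under the above convergence. -/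
instance {X : Type*} [PseudoEMetricSpace X] (o : X) :
    TopologicalSpace (GromovCompactification o) :=
  TopologicalSpace.ofClosed
    {B | ∀ (u : ℕ → GromovCompactification o) (ξ : GromovCompactification o),
      (∀ n, u n ∈ B) → GromovConverges o u ξ → ξ ∈ B}
    (fun _ _ hu _ => (hu 0).elim)
    (fun _ hA u ξ hu hξ B hB => hA hB u ξ (fun n => hu n B hB) hξ)
    (by
      intro A hA B hB u ξ hu hξ
      by_cases hfreq : ∃ᶠ n in atTop, u n ∈ A
      · obtain ⟨σ, hσ, hσA⟩ := extraction_of_frequently_atTop hfreq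
        exact Or.inl (hA (u ∘ σ) ξ hσA (hξ.comp hσ))
      · rw [not_frequently] at hfreq
        obtain ⟨σ, hσ, hσA⟩ := extraction_of_eventually_atTop hfreq
        exact Or.inr (hB (u ∘ σ) ξ (fun n => (hu (σ n)).resolve_left (hσA n)) (hξ.comp hσ)))

/-! ## Geodesic subspaces, visibility subspaces, geodesic loops -/

/-- The subset of `ℂᵈ` underlying a subset of `(M, k_M)`. -/
def euclSet {d : ℕ} {M : Set (CSpace d)} (S : Set (KobayashiSpace M)) : Set (CSpace d) :=
  KobayashiSpace.val '' S

/-- Geodesic subspaces of `M`: `(S, k_M)` is Cauchy-complete, and any two distinct points of `S`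
are joined by a geodesic of `(M, k_M)` that lies in `S`. -/
def IsGeodesicSubspace {d : ℕ} {M : Set (CSpace d)} (S : Set (KobayashiSpace M)) : Prop :=
  IsComplete S ∧ ∀ x ∈ S, ∀ y ∈ S, x ≠ y → ∃ (L : ℝ) (γ : ℝ → KobayashiSpace M),
    IsGeodesicSegment γ L ∧ γ 0 = x ∧ γ L = y ∧ ∀ t ∈ Icc (0 : ℝ) L, γ t ∈ S

/-- Visibility subspaces of `M`. Closures, neighbourhoods and compactness are those of `ℂᵈ`. -/
def IsVisibilitySubspace {d : ℕ} {M : Set (CSpace d)} (S : Set (KobayashiSpace M)) : Prop :=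
  IsGeodesicSubspace S ∧
    ∀ p ∈ closure (euclSet S) \ euclSet S, ∀ q ∈ closure (euclSet S) \ euclSet S, p ≠ q →
      ∃ U ∈ 𝓝 p, ∃ V ∈ 𝓝 q, ∃ K : Set (CSpace d), IsCompact K ∧ K ⊆ euclSet S ∧
        closure U ∩ closure V = ∅ ∧
        ∀ (L : ℝ) (γ : ℝ → KobayashiSpace M), IsGeodesicSegment γ L →
          (∀ t ∈ Icc (0 : ℝ) L, γ t ∈ S) → (γ 0).val ∈ U → (γ L).val ∈ V →
            ∃ t ∈ Icc (0 : ℝ) L, (γ t).val ∈ K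

/-- Geodesic loops of `S` in the Euclidean closure of `S`: geodesic lines in `S` with the same
set of (Euclidean) limit points at `∞` and at `-∞`. -/
def IsGeodesicLoop {d : ℕ} {M : Set (CSpace d)} (S : Set (KobayashiSpace M))
    (γ : ℝ → KobayashiSpace M) : Prop :=
  Isometry γ ∧ (∀ t, γ t ∈ S) ∧
    {p : CSpace d | MapClusterPt p atTop fun t => (γ t).val} =
      {p : CSpace d | MapClusterPt p atBot fun t => (γ t).val}

end

/-! On a bounded connected submanifold the Kobayashi distance is a length metric that defines the
Euclidean topology: chains of discs can be cut at any length, the Schwarz lemma bounds the Euclidean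
distance by a multiple of the Kobayashi distance, and small linear discs in charts give the converse
comparison. If it is complete, Hopf–Rinow makes it proper and geodesic, and `f` carries geodesics of
`M` to geodesics in `S`.

Let `g` be `f` followed by the inclusion in `ℂⁿ`. Visibility forces a geodesic running from near one
boundary point of `S` to near another to return to a fixed compact set, which a geodesic already far
from its origin cannot do. Hence, if geodesic segments with lengths tending to infinity converge to
a ray, the `g`-limit of their end points is also the limit of the ray
(`tendsto_of_tendsto_segments`). Constant families show that rays land in `ℂⁿ`; equivalent rays land
at the same point (`eq_of_tendsto_of_equiv`), which defines the extension `F`. Varying families give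
its sequential continuity (`IsRadialExtension.eq_of_tendsto`), and with Arzelà–Ascoli also that `F`
is closed and has image `closure (range g)`.

Hyperbolicity gives injectivity: two inequivalent rays are joined by a geodesic line landing at the
same points as the rays (`exists_line`), so a coincidence of these points yields a geodesic loop.
Without loops `F` is a continuous closed bijection onto the closure of `S`. -/

/-! ### Length metrics: properness and existence of geodesics -/

/-- A metric is a length metric if every two points at distance less than `a + b` have a point
at distance at most `a` from the first and at most `b` from the second. -/
def IsLengthMetric (X : Type*) [PseudoMetricSpace X] : Prop :=
  ∀ (x y : X) (a b : ℝ), 0 ≤ a → 0 ≤ b → dist x y < a + b → ∃ z, dist x z ≤ a ∧ dist z y ≤ b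

/-- **Hopf–Rinow**: a complete, locally compact length metric is proper. -/
lemma IsLengthMetric.properSpace {X : Type*} [MetricSpace X] [CompleteSpace X]
    [LocallyCompactSpace X] (h : IsLengthMetric X) : ProperSpace X := by
  refine ⟨fun o r₀ => ?_⟩
  by_contra hr₀
  -- The ball whose radius is the supremum `R` of `S` is shown to be compact as well; a compact
  -- thickening of it then contains a ball of radius greater than `R`.
  set S : Set ℝ := {r | 0 ≤ r ∧ IsCompact (Metric.closedBall o r)} with hS
  have h0 : (0 : ℝ) ∈ S := ⟨le_rfl, by simp⟩
  have hub : ∀ r ∈ S, r ≤ r₀ := by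
    intro r hr
    by_contra hlt
    exact hr₀ (hr.2.of_isClosed_subset Metric.isClosed_closedBall
      (Metric.closedBall_subset_closedBall (not_le.1 hlt).le))
  have hbdd : BddAbove S := ⟨r₀, hub⟩
  set R := sSup S with hR
  have hR0 : 0 ≤ R := le_csSup hbdd h0
  have hlt : ∀ r < R, IsCompact (Metric.closedBall o r) := by
    intro r hr
    obtain ⟨s, hs, hrs⟩ := exists_lt_of_lt_csSup ⟨0, h0⟩ hr
    exact hs.2.of_isClosed_subset Metric.isClosed_closedBall
      (Metric.closedBall_subset_closedBall hrs.le)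
  have hRc : IsCompact (Metric.closedBall o R) := by
    rcases hR0.eq_or_lt with h' | hRpos
    · rw [← h']; exact h0.2
    refine TotallyBounded.isCompact_of_isClosed ?_ Metric.isClosed_closedBall
    rw [Metric.totallyBounded_iff]
    intro ε hε
    -- A point within `R` of `o` is within `2 * δ` of the compact ball of radius `R - δ`. The excess
    -- `δ` provides the strict inequality required by `IsLengthMetric`, and `2 * δ + ε / 3 ≤ ε`.
    set δ := min (ε / 3) (R / 2) with hδ
    have hδ0 : 0 < δ := by positivity
    have hδε : δ ≤ ε / 3 := min_le_left _ _
    have hδR : δ ≤ R / 2 := min_le_right _ _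
    obtain ⟨t, ht, htc⟩ := Metric.totallyBounded_iff.1
      (hlt (R - δ) (by linarith)).totallyBounded (ε / 3) (by positivity)
    refine ⟨t, ht, fun x hx => ?_⟩
    rw [Metric.mem_closedBall, dist_comm] at hx
    obtain ⟨z, hz, hzx⟩ := h o x (R - δ) (2 * δ) (by linarith) (by linarith) (by linarith)
    obtain ⟨y, hy, hzy⟩ := mem_iUnion₂.1 (htc (by rwa [Metric.mem_closedBall, dist_comm] :
      z ∈ Metric.closedBall o (R - δ)))
    refine mem_iUnion₂.2 ⟨y, hy, ?_⟩
    rw [Metric.mem_ball] at hzy ⊢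
    have := dist_triangle x z y
    rw [dist_comm x z] at this
    linarith
  obtain ⟨δ, hδ, hc⟩ := hRc.exists_isCompact_cthickening
  have hmem : R + δ / 2 ∈ S := by
    refine ⟨by linarith, hc.of_isClosed_subset Metric.isClosed_closedBall fun x hx => ?_⟩
    rw [Metric.mem_closedBall, dist_comm] at hx
    obtain ⟨z, hz, hzx⟩ := h o x R δ hR0 hδ.le (by linarith)
    exact Metric.mem_cthickening_of_dist_le x z δ _
      (by rwa [Metric.mem_closedBall, dist_comm]) (by rwa [dist_comm])
  linarith [le_csSup hbdd hmem]

/-- A point of the compact ball of radius `a` about `x` that is nearest to `y` does at least as well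
as the points obtained for every `b + ε`. This removes the strictness from the definition. -/
lemma IsLengthMetric.exists_between {X : Type*} [PseudoMetricSpace X] [ProperSpace X]
    (h : IsLengthMetric X) (x y : X) {a b : ℝ} (ha : 0 ≤ a) (hb : 0 ≤ b) (hab : dist x y ≤ a + b) :
    ∃ z, dist x z ≤ a ∧ dist z y ≤ b := by
  obtain ⟨z, hz, hmin⟩ := (isCompact_closedBall x a).exists_isMinOn
    ⟨x, Metric.mem_closedBall_self ha⟩ (f := fun z => dist z y) (by fun_prop)
  refine ⟨z, by rwa [Metric.mem_closedBall, dist_comm] at hz, le_of_forall_pos_le_add fun ε hε => ?_⟩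
  obtain ⟨w, hw, hwy⟩ := h x y a (b + ε) ha (by linarith) (by linarith)
  exact (hmin (by rwa [Metric.mem_closedBall, dist_comm] : w ∈ Metric.closedBall x a)).trans hwy

lemma Ultrafilter.exists_tendsto_of_dist_le {X ι : Type*} [PseudoMetricSpace X] [ProperSpace X]
    (l : Ultrafilter ι) (c : ι → X) (o : X) (C : ℝ) (h : ∀ i, dist (c i) o ≤ C) :
    ∃ z, Tendsto c l (𝓝 z) := by
  obtain ⟨z, -, hz⟩ := (isCompact_closedBall o C).ultrafilter_le_nhds (l.map c)
    (by
      rw [Ultrafilter.coe_map, le_principal_iff, Filter.mem_map]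
      exact Filter.univ_mem' h)
  exact ⟨z, hz⟩

lemma isGeodesicSegment_iff_dist {X : Type*} [PseudoMetricSpace X] {γ : ℝ → X} {L : ℝ} :
    IsGeodesicSegment γ L ↔
      0 ≤ L ∧ ∀ s ∈ Icc (0 : ℝ) L, ∀ t ∈ Icc (0 : ℝ) L, dist (γ s) (γ t) = |s - t| := by
  unfold IsGeodesicSegment
  refine and_congr_right fun _ => forall₄_congr fun s _ t _ => ?_
  rw [edist_dist, edist_dist, ENNReal.ofReal_eq_ofReal_iff dist_nonneg dist_nonneg, Real.dist_eq]

/-- A 1-Lipschitz map of an interval whose end points are at the maximal distance is a geodesic. -/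
lemma isGeodesicSegment_of_dist_le {X : Type*} [PseudoMetricSpace X] {γ : ℝ → X} {L : ℝ}
    (hL : 0 ≤ L) (h : ∀ s ∈ Icc (0 : ℝ) L, ∀ t ∈ Icc (0 : ℝ) L, dist (γ s) (γ t) ≤ |s - t|)
    (hd : L ≤ dist (γ 0) (γ L)) : IsGeodesicSegment γ L := by
  have key : ∀ s ∈ Icc (0 : ℝ) L, ∀ t ∈ Icc (0 : ℝ) L, s ≤ t → dist (γ s) (γ t) = |s - t| := by
    intro s hs t ht hst
    refine le_antisymm (h s hs t ht) ?_
    have h1 := h 0 ⟨le_rfl, hL⟩ s hs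
    have h2 := h t ht L ⟨hL, le_rfl⟩
    have h3 := dist_triangle4 (γ 0) (γ s) (γ t) (γ L)
    rw [zero_sub, abs_neg, abs_of_nonneg hs.1] at h1
    rw [abs_sub_comm, abs_of_nonneg (by linarith [ht.2])] at h2
    rw [abs_sub_comm, abs_of_nonneg (by linarith)]
    linarith
  refine isGeodesicSegment_iff_dist.2 ⟨hL, fun s hs t ht => ?_⟩
  rcases le_total s t with hst | hst
  · exact key s hs t ht hst
  · rw [dist_comm, abs_sub_comm]
    exact key t ht s hs hst

/-- A proper length metric is geodesic. -/
lemma IsLengthMetric.exists_isGeodesicSegment {X : Type*} [MetricSpace X] [ProperSpace X]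
    (h : IsLengthMetric X) (x y : X) :
    ∃ (L : ℝ) (γ : ℝ → X), IsGeodesicSegment γ L ∧ γ 0 = x ∧ γ L = y := by
  set L := dist x y with hL
  have hL0 : 0 ≤ L := dist_nonneg
  have hstep : ∀ (n : ℕ) (z : X), ∃ w, dist z w ≤ 1 / ((n : ℝ) + 1) ∧
      dist w y ≤ max (dist z y - 1 / ((n : ℝ) + 1)) 0 := fun n z =>
    h.exists_between z y (by positivity) (le_max_right _ _)
      (by linarith [le_max_left (dist z y - 1 / ((n : ℝ) + 1)) 0])
  -- A greedy walk towards `y`: each step has length at most `1 / (n + 1)` and lowers the distance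
  -- to `y` by that amount, until it is zero.
  choose step hs1 hs2 using hstep
  set u : ℕ → ℕ → X := fun n i => (step n)^[i] x with hu
  have hsucc : ∀ n i, u n (i + 1) = step n (u n i) := fun n i => Function.iterate_succ_apply' _ _ _
  have hdist : ∀ n i k : ℕ, dist (u n i) (u n (i + k)) ≤ k * (1 / ((n : ℝ) + 1)) := by
    intro n i k
    induction k with
    | zero => simp
    | succ k ih =>
      have h1 := dist_triangle (u n i) (u n (i + k)) (u n (i + k + 1))
      have h2 := hs1 n (u n (i + k))
      rw [← hsucc] at h2
      rw [← add_assoc]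
      push_cast
      linarith
  have hend : ∀ n i : ℕ, dist (u n i) y ≤ max (L - i * (1 / ((n : ℝ) + 1))) 0 := by
    intro n i
    induction i with
    | zero => simp [hu, hL]
    | succ i ih =>
      rw [hsucc]
      refine (hs2 n (u n i)).trans (max_le ?_ (le_max_right _ _))
      have hpos : 0 ≤ 1 / ((n : ℝ) + 1) := by positivity
      rcases le_max_iff.1 ih with h1 | h1
      · refine le_max_of_le_left ?_
        push_cast
        linarith
      · exact le_max_of_le_right (by linarith)
  -- The walks, run at unit speed, are 1-Lipschitz up to an error `1 / (n + 1)`. Limits along a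
  -- single ultrafilter exist at all times at once, so no diagonal extraction is needed.
  set c : ℕ → ℝ → X := fun n t => u n ⌊t * (n + 1)⌋₊ with hc
  have hε : Tendsto (fun n : ℕ => 1 / ((n : ℝ) + 1)) (hyperfilter ℕ : Ultrafilter ℕ) (𝓝 0) :=
    tendsto_one_div_add_atTop_nhds_zero_nat.mono_left Nat.hyperfilter_le_atTop
  have hlip : ∀ s t : ℝ, 0 ≤ s → s ≤ t → ∀ n, dist (c n s) (c n t) ≤ |s - t| + 1 / ((n : ℝ) + 1) := by
    intro s t hs hst n
    have hn : (0 : ℝ) < n + 1 := by positivity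
    have hfl : ⌊s * (n + 1)⌋₊ ≤ ⌊t * ((n : ℝ) + 1)⌋₊ := Nat.floor_mono (by gcongr)
    obtain ⟨k, hk⟩ := Nat.exists_eq_add_of_le hfl
    have h1 := hdist n ⌊s * ((n : ℝ) + 1)⌋₊ k
    rw [← hk] at h1
    refine h1.trans ?_
    rw [abs_sub_comm, abs_of_nonneg (by linarith), mul_one_div, ← sub_le_iff_le_add, ← sub_div,
      div_le_iff₀ hn]
    have h2 := Nat.floor_le (show 0 ≤ t * ((n : ℝ) + 1) from mul_nonneg (hs.trans hst) hn.le)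
    have h3 := Nat.lt_floor_add_one (s * ((n : ℝ) + 1))
    have h4 : ((⌊t * ((n : ℝ) + 1)⌋₊ : ℕ) : ℝ) = ⌊s * ((n : ℝ) + 1)⌋₊ + k := by exact_mod_cast hk
    linarith
  have hc0 : ∀ n, c n 0 = x := fun n => by simp [hc, hu]
  have hlim : ∀ t : ℝ, ∃ z, 0 ≤ t → Tendsto (fun n => c n t) (hyperfilter ℕ : Ultrafilter ℕ) (𝓝 z) := by
    intro t
    by_cases ht : 0 ≤ t
    · obtain ⟨z, hz⟩ := (hyperfilter ℕ).exists_tendsto_of_dist_le (fun n => c n t) x (|0 - t| + 1) (by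
        intro n
        rw [dist_comm, ← hc0 n]
        refine (hlip 0 t le_rfl ht n).trans ?_
        gcongr
        rw [div_le_one (by positivity)]
        linarith [(Nat.cast_nonneg n : (0 : ℝ) ≤ n)])
      exact ⟨z, fun _ => hz⟩
    · exact ⟨x, fun h => absurd h ht⟩
  choose γ hγ using hlim
  have hγlip : ∀ s t : ℝ, 0 ≤ s → s ≤ t → dist (γ s) (γ t) ≤ |s - t| := by
    intro s t hs hst
    refine le_of_tendsto_of_tendsto' ((hγ s hs).dist (hγ t (hs.trans hst)))
      (by simpa using hε.const_add |s - t|) (hlip s t hs hst)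
  have hγ0 : γ 0 = x := by
    have := hγ 0 le_rfl
    simp only [hc0] at this
    exact tendsto_nhds_unique this tendsto_const_nhds |>.symm ▸ rfl
  have hγL : γ L = y := by
    rw [← dist_le_zero]
    refine le_of_tendsto_of_tendsto' ((hγ L hL0).dist tendsto_const_nhds) hε fun n => ?_
    have hn : (0 : ℝ) < n + 1 := by positivity
    refine (hend n _).trans (max_le ?_ (by positivity))
    rw [mul_one_div, sub_le_iff_le_add, ← add_div, le_div_iff₀ hn]
    linarith [Nat.lt_floor_add_one (L * ((n : ℝ) + 1))]
  refine ⟨L, γ, isGeodesicSegment_of_dist_le hL0 ?_ (by rw [hγ0, hγL]), hγ0, hγL⟩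
  intro s hs t ht
  rcases le_total s t with hst | hst
  · exact hγlip s t hs.1 hst
  · rw [dist_comm, abs_sub_comm]
    exact hγlip t s ht.1 hst

/-! ### Limits of geodesics under a visible embedding -/

/-- An embedding with relatively compact image for which the geodesics joining neighbourhoods of
two distinct boundary points of the image meet a common compact set. -/
structure IsVisibleEmbedding {X E : Type*} [MetricSpace X] [MetricSpace E] (g : X → E) : Prop where
  isEmbedding : IsEmbedding g
  isCompact_closure : IsCompact (closure (range g))
  visible : ∀ p ∈ closure (range g) \ range g, ∀ q ∈ closure (range g) \ range g, p ≠ q →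
    ∃ U ∈ 𝓝 p, ∃ V ∈ 𝓝 q, ∃ K : Set X, IsCompact K ∧ ∀ (L : ℝ) (γ : ℝ → X),
      IsGeodesicSegment γ L → g (γ 0) ∈ U → g (γ L) ∈ V → ∃ t ∈ Icc (0 : ℝ) L, γ t ∈ K

namespace IsVisibleEmbedding

variable {X E : Type*} [MetricSpace X] [MetricSpace E] {g : X → E}

/-- Since `g` is an embedding, a cluster point `g x` would make `c` itself cluster at `x`, although
`c` leaves every ball about `o`. -/
lemma notMem_range_of_mapClusterPt (hg : IsVisibleEmbedding g) {ι : Type*} {l : Filter ι}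
    {c : ι → X} {o : X} {t : ι → ℝ} (ht : Tendsto t l atTop) (h : ∀ᶠ i in l, t i ≤ dist o (c i))
    {p : E} (hp : MapClusterPt p l (fun i => g (c i))) : p ∈ closure (range g) \ range g := by
  refine ⟨?_, ?_⟩
  · rw [mem_closure_iff_nhds]
    intro U hU
    obtain ⟨i, hi⟩ := (hp.frequently hU).exists
    exact ⟨_, hi, mem_range_self _⟩
  · rintro ⟨x, rfl⟩
    have hx : MapClusterPt x l c := by
      rw [mapClusterPt_iff_ultrafilter] at hp ⊢
      obtain ⟨u, hu, hux⟩ := hp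
      exact ⟨u, hu, hg.isEmbedding.tendsto_nhds_iff.2 hux⟩
    obtain ⟨i, hi, hi1, hi2⟩ := ((hx.frequently (Metric.ball_mem_nhds x one_pos)).and_eventually
      (h.and (ht.eventually_gt_atTop (dist o x + 1)))).exists
    have := dist_triangle o x (c i)
    rw [dist_comm x] at this
    linarith

/-- If geodesic segments `c i` of lengths `t i → ∞` converge pointwise to a ray `c'` and the images
of their end points converge to `q`, then the image of the ray converges to `q`. -/
lemma tendsto_of_tendsto_segments (hg : IsVisibleEmbedding g) {ι : Type*} {l : Filter ι} [l.NeBot]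
    {c : ι → ℝ → X} {t : ι → ℝ} {c' : ℝ → X} {q : E} (ht : Tendsto t l atTop)
    (hc : ∀ i, IsGeodesicSegment (c i) (t i))
    (hlim : ∀ s, 0 ≤ s → Tendsto (fun i => c i s) l (𝓝 (c' s)))
    (hq : Tendsto (fun i => g (c i (t i))) l (𝓝 q)) :
    Tendsto (fun s => g (c' s)) atTop (𝓝 q) := by
  simp only [isGeodesicSegment_iff_dist] at hc
  have hc' : ∀ s, 0 ≤ s → dist (c' 0) (c' s) = s := by
    intro s hs
    refine tendsto_nhds_unique ((hlim 0 le_rfl).dist (hlim s hs)) ?_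
    refine tendsto_const_nhds.congr' ?_
    filter_upwards [ht.eventually_ge_atTop s] with i hi
    rw [(hc i).2 0 ⟨le_rfl, (hc i).1⟩ s ⟨hs, hi⟩, zero_sub, abs_neg, abs_of_nonneg hs]
  have hnear : ∀ᶠ i in l, dist (c i 0) (c' 0) < 1 :=
    (hlim 0 le_rfl).eventually (Metric.ball_mem_nhds _ one_pos)
  refine hg.isCompact_closure.tendsto_nhds_of_unique_mapClusterPt
    (Eventually.of_forall fun s => subset_closure (mem_range_self _)) fun p _ hp => ?_
  by_contra hpq
  have hp' := hg.notMem_range_of_mapClusterPt (o := c' 0) tendsto_id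
    ((eventually_ge_atTop 0).mono fun s hs => (hc' s hs).ge) hp
  have hq' : q ∈ closure (range g) \ range g := by
    refine hg.notMem_range_of_mapClusterPt (o := c' 0) (tendsto_atTop_add_const_right _ (-1) ht)
      ?_ hq.mapClusterPt
    filter_upwards [hnear] with i hi
    have h1 := (hc i).2 0 ⟨le_rfl, (hc i).1⟩ (t i) ⟨(hc i).1, le_rfl⟩
    rw [zero_sub, abs_neg, abs_of_nonneg (hc i).1] at h1
    have := dist_triangle (c i 0) (c' 0) (c i (t i))
    linarith
  obtain ⟨U, hU, V, hV, K, hK, hvis⟩ := hg.visible p hp' q hq' hpq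
  obtain ⟨C, hC⟩ := hK.isBounded.subset_closedBall (c' 0)
  -- Past time `T > C + 1` the segments stay more than `C` away from `c' 0`, so they miss `K`; the
  -- `1` absorbs the distance from `c i 0` to `c' 0`. The pieces on `[T, t i]` contradict
  -- visibility.
  obtain ⟨T, hTU, hT0, hTC⟩ := ((hp.frequently (interior_mem_nhds.2 hU)).and_eventually
    ((eventually_ge_atTop (0 : ℝ)).and (eventually_gt_atTop (C + 1)))).exists
  have hTU' : ∀ᶠ i in l, g (c i T) ∈ U :=
    ((hg.isEmbedding.continuous.tendsto _).comp (hlim T hT0)).eventually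
      (mem_interior_iff_mem_nhds.1 hTU)
  obtain ⟨i, hi1, hi2, hi3, hi4⟩ := (hTU'.and ((hq.eventually hV).and
    ((ht.eventually_ge_atTop T).and hnear))).exists
  obtain ⟨s, hs, hsK⟩ := hvis (t i - T) (fun s => c i (T + s))
    (isGeodesicSegment_iff_dist.2 ⟨by linarith, fun a ha b hb => by
      rw [(hc i).2 (T + a) ⟨by linarith [ha.1], by linarith [ha.2]⟩ (T + b)
        ⟨by linarith [hb.1], by linarith [hb.2]⟩, add_sub_add_left_eq_sub]⟩)
    (by simpa using hi1) (by simp only [add_sub_cancel]; exact hi2)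
  have h1 := hC hsK
  rw [Metric.mem_closedBall, dist_comm] at h1
  have h2 := (hc i).2 0 ⟨le_rfl, (hc i).1⟩ (T + s) ⟨by linarith [hs.1], by linarith [hs.2]⟩
  rw [zero_sub, abs_neg, abs_of_nonneg (by linarith [hs.1])] at h2
  have := dist_triangle (c i 0) (c' 0) (c i (T + s))
  linarith [hs.1]

/-- The image of a geodesic ray converges. -/
lemma exists_tendsto_ray (hg : IsVisibleEmbedding g) {c : ℝ → X}
    (hc : ∀ s, 0 ≤ s → ∀ t, 0 ≤ t → dist (c s) (c t) = |s - t|) :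
    ∃ p ∈ closure (range g) \ range g, Tendsto (fun s => g (c s)) atTop (𝓝 p) := by
  set l : Ultrafilter ℝ := Ultrafilter.of atTop
  have hl : (l : Filter ℝ) ≤ atTop := Ultrafilter.of_le _
  obtain ⟨p, -, hp⟩ := hg.isCompact_closure.ultrafilter_le_nhds (l.map fun s => g (c (max s 0)))
    (by
      rw [Ultrafilter.coe_map, le_principal_iff, Filter.mem_map]
      exact Filter.univ_mem' fun s => subset_closure (mem_range_self _))
  -- The family is constant and only the cutting time varies, along an ultrafilter for which the end
  -- points converge by compactness.
  have h := hg.tendsto_of_tendsto_segments (l := (l : Filter ℝ)) (c := fun _ => c) (c' := c)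
    (t := fun s => max s 0) (q := p) ((tendsto_atTop_mono (le_max_left · 0) tendsto_id).mono_left hl)
    (fun s => isGeodesicSegment_iff_dist.2
      ⟨le_max_right _ _, fun a ha b hb => hc a ha.1 b hb.1⟩)
    (fun s _ => tendsto_const_nhds) hp
  refine ⟨p, hg.notMem_range_of_mapClusterPt (o := c 0) tendsto_id ?_ h.mapClusterPt, h⟩
  filter_upwards [eventually_ge_atTop 0] with s hs
  rw [hc 0 le_rfl s hs, zero_sub, abs_neg, abs_of_nonneg hs]
  rfl

end IsVisibleEmbedding

/-! ### Generalized rays -/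

/-- `c` is a unit speed geodesic from `o` on `[0, R]` that stays constant after time `R ≤ ∞`. -/
def IsTruncatedRay {X : Type*} [PseudoMetricSpace X] (o : X) (c : ℝ≥0 → X) (R : ℝ≥0∞) : Prop :=
  c 0 = o ∧ ∀ s t : ℝ≥0,
    dist (c s) (c t) = |(min (s : ℝ≥0∞) R).toReal - (min (t : ℝ≥0∞) R).toReal|

namespace IsTruncatedRay

variable {X : Type*} [MetricSpace X] {o : X} {c : ℝ≥0 → X} {R : ℝ≥0∞}

lemma dist_eq (h : IsTruncatedRay o c R) {s t : ℝ≥0} (hs : s ≤ R) (ht : t ≤ R) :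
    dist (c s) (c t) = |(s : ℝ) - t| := by
  rw [h.2, min_eq_left hs, min_eq_left ht, ENNReal.coe_toReal, ENNReal.coe_toReal]

lemma lipschitzWith (h : IsTruncatedRay o c R) : LipschitzWith 1 c := by
  refine LipschitzWith.of_dist_le_mul fun s t => ?_
  rw [h.2, NNReal.coe_one, one_mul, NNReal.dist_eq]
  induction R with
  | top => simp
  | coe r =>
    rw [← ENNReal.coe_min, ← ENNReal.coe_min, ENNReal.coe_toReal, ENNReal.coe_toReal,
      NNReal.coe_min, NNReal.coe_min]
    exact (abs_min_sub_min_le_max _ _ _ _).trans (by simp)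

lemma eq_of_le (h : IsTruncatedRay o c R) {s t : ℝ≥0} (hs : R ≤ s) (ht : R ≤ t) : c s = c t := by
  rw [← dist_eq_zero, h.2, min_eq_right hs, min_eq_right ht, sub_self, abs_zero]

lemma isGeodesicSegment (h : IsTruncatedRay o c R) {T : ℝ≥0} (hT : T ≤ R) :
    IsGeodesicSegment (fun s : ℝ => c s.toNNReal) T := by
  refine isGeodesicSegment_iff_dist.2 ⟨T.2, fun s hs t ht => ?_⟩
  rw [h.dist_eq (le_trans (by exact_mod_cast Real.toNNReal_le_iff_le_coe.2 hs.2) hT)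
    (le_trans (by exact_mod_cast Real.toNNReal_le_iff_le_coe.2 ht.2) hT),
    Real.coe_toNNReal _ hs.1, Real.coe_toNNReal _ ht.1]

end IsTruncatedRay

section

variable {X : Type*} [MetricSpace X] {o : X} {c : ℝ≥0 → X}

lemma IsGeneralizedRay.isTruncatedRay_point {x : X}
    (h : IsGeneralizedRay o c (.point x)) :
    ∃ R : ℝ≥0, IsTruncatedRay o c R ∧ ∀ t, R ≤ t → c t = x := by
  obtain ⟨R, h0, hd, hx⟩ := h
  have hmin : ∀ s, c s = c (min s R) := by
    intro s
    rcases le_total s R with hs | hs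
    · rw [min_eq_left hs]
    · rw [min_eq_right hs, hx s hs, hx R le_rfl]
  refine ⟨R, ⟨h0, fun s t => ?_⟩, hx⟩
  rw [hmin s, hmin t, dist_edist, hd _ (min_le_right _ _) _ (min_le_right _ _), ← dist_edist,
    NNReal.dist_eq, ← ENNReal.coe_min, ← ENNReal.coe_min, ENNReal.coe_toReal, ENNReal.coe_toReal]

lemma GeodesicRay.isTruncatedRay (γ : GeodesicRay o) : IsTruncatedRay o γ.toFun ⊤ := by
  refine ⟨γ.start, fun s t => ?_⟩
  rw [γ.isometry.dist_eq, NNReal.dist_eq]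
  simp

lemma IsGeneralizedRay.isTruncatedRay_ideal {ξ : GromovBoundary o}
    (h : IsGeneralizedRay o c (.ideal ξ)) : IsTruncatedRay o c ⊤ := by
  obtain ⟨γ, rfl, -⟩ := h
  exact γ.isTruncatedRay

lemma IsGeneralizedRay.exists_isTruncatedRay {ξ : GromovCompactification o}
    (h : IsGeneralizedRay o c ξ) : ∃ R, IsTruncatedRay o c R := by
  cases ξ with
  | point x => exact ⟨_, h.isTruncatedRay_point.choose_spec.1⟩
  | ideal ξ => exact ⟨⊤, h.isTruncatedRay_ideal⟩

lemma IsTruncatedRay.exists_isGeneralizedRay {R : ℝ≥0∞} (h : IsTruncatedRay o c R) :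
    ∃ ξ, IsGeneralizedRay o c ξ := by
  induction R with
  | top =>
    refine ⟨.ideal (Quotient.mk _ ⟨c, Isometry.of_dist_eq fun s t => ?_, h.1⟩), _, rfl, rfl⟩
    rw [h.dist_eq le_top le_top, NNReal.dist_eq]
  | coe R =>
    refine ⟨.point (c R), R, h.1, fun s hs t ht => ?_, fun t ht => ?_⟩
    · rw [edist_dist, edist_dist, NNReal.dist_eq,
        h.dist_eq (ENNReal.coe_le_coe.2 hs) (ENNReal.coe_le_coe.2 ht)]
    · exact h.eq_of_le (ENNReal.coe_le_coe.2 ht) le_rfl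

/-- In a geodesic space every point of the compactification is joined to `o` by a generalized ray. -/
lemma exists_isGeneralizedRay
    (hgeo : ∀ x y : X, ∃ (L : ℝ) (γ : ℝ → X), IsGeodesicSegment γ L ∧ γ 0 = x ∧ γ L = y)
    (ξ : GromovCompactification o) : ∃ c, IsGeneralizedRay o c ξ := by
  cases ξ with
  | point x =>
    obtain ⟨L, γ, hγ, h0, hL⟩ := hgeo o x
    refine ⟨fun t => γ (min (t : ℝ) L), L.toNNReal, ?_, fun s hs t ht => ?_, fun t ht => ?_⟩
    · simp [hγ.1, h0]
    · rw [Real.le_toNNReal_iff_coe_le hγ.1] at hs ht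
      simp only [min_eq_left hs, min_eq_left ht]
      exact hγ.2 s ⟨s.2, hs⟩ t ⟨t.2, ht⟩
    · rw [Real.toNNReal_le_iff_le_coe] at ht
      simp only [min_eq_right ht, hL]
  | ideal ξ =>
    obtain ⟨γ, rfl⟩ := Quotient.exists_rep ξ
    exact ⟨γ.toFun, γ, rfl, rfl⟩

/-- Sequential compactness of the set of truncated rays, for locally uniform convergence. -/
lemma exists_subseq_tendsto_isTruncatedRay [ProperSpace X] (c : ℕ → ℝ≥0 → X) (R : ℕ → ℝ≥0∞)
    (hc : ∀ n, IsTruncatedRay o (c n) (R n)) :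
    ∃ φ : ℕ → ℕ, StrictMono φ ∧ ∃ (c' : ℝ≥0 → X) (R' : ℝ≥0∞), IsTruncatedRay o c' R' ∧
      ∀ K : Set ℝ≥0, IsCompact K → TendstoUniformlyOn (fun n => c (φ n)) c' atTop K := by
  -- Lengths live in the compact space `[0, ∞]`, so segments and rays are treated together. The
  -- limit inherits the distance formula because `min s R'` is finite and `toReal` is continuous
  -- there.
  obtain ⟨R', ψ, hψ, hR'⟩ := CompactSpace.tendsto_subseq R
  set S : Set C(ℝ≥0, X) := {f | f 0 = o ∧ LipschitzWith 1 f} with hS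
  have hfun : (ContinuousMap.toFun '' S : Set (ℝ≥0 → X)) =
      {f : ℝ≥0 → X | f 0 = o ∧ ∀ s t, dist (f s) (f t) ≤ dist s t} := by
    ext f
    constructor
    · rintro ⟨F, hF, rfl⟩
      exact ⟨hF.1, fun s t => by simpa using hF.2.dist_le_mul s t⟩
    · rintro ⟨h0, h1⟩
      have hl : LipschitzWith 1 f := LipschitzWith.of_dist_le_mul fun s t => by simpa using h1 s t
      exact ⟨⟨f, hl.continuous⟩, ⟨h0, hl⟩, rfl⟩
  have hcompact : IsCompact S := by
    refine ArzelaAscoli.isCompact_of_equicontinuous S ?_ ?_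
    · rw [hfun]
      refine (isCompact_univ_pi fun t : ℝ≥0 => isCompact_closedBall o (t : ℝ)).of_isClosed_subset
        ?_ ?_
      · have hlip : IsClosed {f : ℝ≥0 → X | ∀ s t, dist (f s) (f t) ≤ dist s t} := by
          simp only [ofPred_forall]
          exact isClosed_iInter fun s => isClosed_iInter fun t =>
            isClosed_le ((continuous_apply s).dist (continuous_apply t)) continuous_const
        exact (isClosed_eq (continuous_apply 0) continuous_const).inter hlip
      · rintro f ⟨h0, h1⟩ t -
        have := h1 t 0
        rw [h0, NNReal.dist_eq] at this
        simpa using this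
    · exact (LipschitzWith.uniformEquicontinuous _ 1 fun f => f.2.2).equicontinuous
  set F : ℕ → C(ℝ≥0, X) := fun n => ⟨c (ψ n), (hc (ψ n)).lipschitzWith.continuous⟩
  obtain ⟨f, -, θ, hθ, hf⟩ := hcompact.isSeqCompact (x := F)
    (fun n => ⟨(hc (ψ n)).1, (hc (ψ n)).lipschitzWith⟩)
  have hf' := ContinuousMap.tendsto_iff_forall_isCompact_tendstoUniformlyOn.1 hf
  have hpt : ∀ s, Tendsto (fun n => c (ψ (θ n)) s) atTop (𝓝 (f s)) := fun s =>
    (hf' {s} isCompact_singleton).tendsto_at rfl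
  refine ⟨ψ ∘ θ, hψ.comp hθ, f, R', ⟨?_, fun s t => ?_⟩, hf'⟩
  · refine tendsto_nhds_unique (hpt 0) ?_
    simp only [(hc _).1]
    exact tendsto_const_nhds
  · have hmin : ∀ s : ℝ≥0, Tendsto (fun n => (min (s : ℝ≥0∞) (R (ψ (θ n)))).toReal) atTop
        (𝓝 (min (s : ℝ≥0∞) R').toReal) := fun s =>
      (ENNReal.tendsto_toReal (min_lt_of_left_lt ENNReal.coe_lt_top).ne).comp
        (tendsto_const_nhds.min (hR'.comp hθ.tendsto_atTop))
    refine tendsto_nhds_unique ((hpt s).dist (hpt t)) ?_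
    simp only [(hc _).2]
    exact ((hmin s).sub (hmin t)).abs

end

/-! ### The extension to the Gromov compactification -/

/-- `F` maps each point `ξ` of the Gromov compactification to the limit of `g` along every
generalized ray to `ξ`. -/
def IsRadialExtension {X E : Type*} [MetricSpace X] [MetricSpace E] {o : X} (g : X → E)
    (F : GromovCompactification o → E) : Prop :=
  ∀ ξ c, IsGeneralizedRay o c ξ → Tendsto (fun t => g (c t)) atTop (𝓝 (F ξ))

lemma GeodesicRay.dist_start {X : Type*} [MetricSpace X] {o : X} (γ : GeodesicRay o) (t : ℝ≥0) :
    dist o (γ.toFun t) = t := by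
  have h := γ.isometry.dist_eq 0 t
  rw [γ.start, NNReal.dist_eq] at h
  simpa using h

namespace IsVisibleEmbedding

variable {X E : Type*} [MetricSpace X] [MetricSpace E] {g : X → E} {o : X}

lemma notMem_range_of_tendsto_geodesicRay (hg : IsVisibleEmbedding g) (γ : GeodesicRay o) {p : E}
    (hp : Tendsto (fun t => g (γ.toFun t)) atTop (𝓝 p)) : p ∈ closure (range g) \ range g :=
  hg.notMem_range_of_mapClusterPt (o := o) (NNReal.tendsto_coe_atTop.2 tendsto_id)
    (Eventually.of_forall fun t => (γ.dist_start t).ge) hp.mapClusterPt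

lemma exists_tendsto_geodesicRay (hg : IsVisibleEmbedding g) (γ : GeodesicRay o) :
    ∃ p, Tendsto (fun t => g (γ.toFun t)) atTop (𝓝 p) := by
  obtain ⟨p, -, hp⟩ := hg.exists_tendsto_ray (c := fun s => γ.toFun s.toNNReal) fun s hs t ht => by
    rw [γ.isometry.dist_eq, NNReal.dist_eq, Real.coe_toNNReal _ hs, Real.coe_toNNReal _ ht]
  refine ⟨p, ?_⟩
  have := hp.comp (NNReal.tendsto_coe_atTop.2 tendsto_id)
  simpa [Function.comp_def] using this

/-- A geodesic from `γ n` to `η n` has length at most `C`, so it stays at distance at least `n - C`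
from `o` and misses any given compact set once `n` is large. Visibility then excludes distinct
limits. -/
lemma eq_of_tendsto_of_equiv (hg : IsVisibleEmbedding g)
    (hgeo : ∀ x y : X, ∃ (L : ℝ) (γ : ℝ → X), IsGeodesicSegment γ L ∧ γ 0 = x ∧ γ L = y)
    {γ η : GeodesicRay o} {C : ℝ≥0} (h : ∀ t, edist (γ.toFun t) (η.toFun t) ≤ C) {p q : E}
    (hp : Tendsto (fun t => g (γ.toFun t)) atTop (𝓝 p))
    (hq : Tendsto (fun t => g (η.toFun t)) atTop (𝓝 q)) : p = q := by
  by_contra hpq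
  obtain ⟨U, hU, V, hV, K, hK, hvis⟩ := hg.visible p (hg.notMem_range_of_tendsto_geodesicRay γ hp)
    q (hg.notMem_range_of_tendsto_geodesicRay η hq) hpq
  obtain ⟨D, hD⟩ := hK.isBounded.subset_closedBall o
  obtain ⟨n, hnU, hnV, hn⟩ := ((hp.eventually hU).and ((hq.eventually hV).and
    ((NNReal.tendsto_coe_atTop.2 tendsto_id).eventually_gt_atTop (C + D : ℝ)))).exists
  obtain ⟨L, σ, hσ, h0, hL⟩ := hgeo (γ.toFun n) (η.toFun n)
  obtain ⟨s, hs, hsK⟩ := hvis L σ hσ (by rwa [h0]) (by rwa [hL])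
  rw [isGeodesicSegment_iff_dist] at hσ
  have h1 := hD hsK
  rw [Metric.mem_closedBall, dist_comm] at h1
  have h2 := hσ.2 0 ⟨le_rfl, hσ.1⟩ s hs
  have h3 := hσ.2 0 ⟨le_rfl, hσ.1⟩ L ⟨hσ.1, le_rfl⟩
  rw [zero_sub, abs_neg, abs_of_nonneg hs.1, h0] at h2
  rw [zero_sub, abs_neg, abs_of_nonneg hσ.1, h0, hL] at h3
  have h4 : dist (γ.toFun n) (η.toFun n) ≤ C := by
    have := h n
    rwa [edist_dist, ENNReal.ofReal_le_iff_le_toReal ENNReal.coe_ne_top, ENNReal.coe_toReal] at this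
  have h5 := dist_triangle o (σ s) (γ.toFun n)
  rw [γ.dist_start, dist_comm (σ s)] at h5
  simp only [id] at hn
  linarith [hs.2]

lemma tendsto_of_isGeneralizedRay_point (g : X → E) {x : X} {c : ℝ≥0 → X}
    (h : IsGeneralizedRay o c (.point x)) : Tendsto (fun t => g (c t)) atTop (𝓝 (g x)) := by
  obtain ⟨R, -, hx⟩ := h.isTruncatedRay_point
  refine tendsto_const_nhds.congr' ?_
  filter_upwards [eventually_ge_atTop R] with t ht
  rw [hx t ht]

lemma exists_isRadialExtension (hg : IsVisibleEmbedding g)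
    (hgeo : ∀ x y : X, ∃ (L : ℝ) (γ : ℝ → X), IsGeodesicSegment γ L ∧ γ 0 = x ∧ γ L = y) (o : X) :
    ∃ F : GromovCompactification o → E, IsRadialExtension g F := by
  have key : ∀ ξ : GromovCompactification o, ∃ p, ∀ c, IsGeneralizedRay o c ξ →
      Tendsto (fun t => g (c t)) atTop (𝓝 p) := by
    intro ξ
    cases ξ with
    | point x => exact ⟨g x, fun c hc => tendsto_of_isGeneralizedRay_point g hc⟩
    | ideal ξ =>
      obtain ⟨γ, rfl⟩ := Quotient.exists_rep ξ
      obtain ⟨p, hp⟩ := hg.exists_tendsto_geodesicRay γ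
      refine ⟨p, ?_⟩
      rintro _ ⟨η, rfl, hη⟩
      obtain ⟨C, hC⟩ := Quotient.exact hη
      obtain ⟨q, hq⟩ := hg.exists_tendsto_geodesicRay η
      rwa [hg.eq_of_tendsto_of_equiv hgeo hC hq hp] at hq
  choose F hF using key
  exact ⟨F, hF⟩

end IsVisibleEmbedding

namespace IsRadialExtension

variable {X E : Type*} [MetricSpace X] [MetricSpace E] {g : X → E} {o : X}
  {F : GromovCompactification o → E}

lemma apply_point (hF : IsRadialExtension g F)
    (hgeo : ∀ x y : X, ∃ (L : ℝ) (γ : ℝ → X), IsGeodesicSegment γ L ∧ γ 0 = x ∧ γ L = y) (x : X) :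
    F (.point x) = g x := by
  obtain ⟨c, hc⟩ := exists_isGeneralizedRay hgeo (.point x : GromovCompactification o)
  exact tendsto_nhds_unique (hF _ c hc) (IsVisibleEmbedding.tendsto_of_isGeneralizedRay_point g hc)

lemma mem_closure (hF : IsRadialExtension g F)
    (hgeo : ∀ x y : X, ∃ (L : ℝ) (γ : ℝ → X), IsGeodesicSegment γ L ∧ γ 0 = x ∧ γ L = y)
    (ξ : GromovCompactification o) : F ξ ∈ closure (range g) := by
  obtain ⟨c, hc⟩ := exists_isGeneralizedRay hgeo ξ
  exact mem_closure_of_tendsto (hF ξ c hc) (Eventually.of_forall fun t => mem_range_self _)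

lemma tendsto_mk (hF : IsRadialExtension g F) (γ : GeodesicRay o) :
    Tendsto (fun t => g (γ.toFun t)) atTop (𝓝 (F (.ideal (Quotient.mk _ γ)))) :=
  hF _ _ ⟨γ, rfl, rfl⟩

/-- Sequential continuity of a radial extension. -/
lemma eq_of_tendsto (hg : IsVisibleEmbedding g) (hF : IsRadialExtension g F)
    {u : ℕ → GromovCompactification o} {ξ : GromovCompactification o} {c : ℕ → ℝ≥0 → X}
    {c' : ℝ≥0 → X} (hc : ∀ n, IsGeneralizedRay o (c n) (u n)) (hc' : IsGeneralizedRay o c' ξ)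
    (hlim : ∀ s, Tendsto (fun n => c n s) atTop (𝓝 (c' s))) {q : E}
    (hq : Tendsto (fun n => F (u n)) atTop (𝓝 q)) : q = F ξ := by
  have htr := fun n => (hc n).exists_isTruncatedRay
  choose R hR using htr
  have hFξ := hF ξ c' hc'
  cases ξ with
  | point x =>
    obtain ⟨r, -, hx⟩ := hc'.isTruncatedRay_point
    have hFx : F (.point x) = g x := tendsto_nhds_unique hFξ
      (IsVisibleEmbedding.tendsto_of_isGeneralizedRay_point g hc')
    rw [hFx]
    -- The limit is at rest after time `r`. If `c n` were still moving at time `r + 2`, its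
    -- positions at `r + 1` and `r + 2` would be at distance exactly 1; so `c n` has stopped by
    -- then, and `F (u n)` is the value of `g` there.
    have h1 := hlim (r + 1)
    have h2 := hlim (r + 2)
    rw [hx _ (by simp)] at h1 h2
    have h3 : ∀ᶠ n in atTop, dist (c n (r + 1)) (c n (r + 2)) < 1 := by
      have := h1.dist h2
      rw [dist_self] at this
      exact this.eventually_lt_const one_pos
    refine tendsto_nhds_unique hq (((hg.isEmbedding.continuous.tendsto x).comp h2).congr' ?_)
    filter_upwards [h3] with n hn
    have hRn : R n ≤ (r + 2 : ℝ≥0) := by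
      by_contra hlt
      push Not at hlt
      have hle : ((r + 1 : ℝ≥0) : ℝ≥0∞) ≤ R n :=
        le_trans (ENNReal.coe_le_coe.2 (by gcongr; norm_num)) hlt.le
      rw [(hR n).dist_eq hle hlt.le] at hn
      push_cast at hn
      rw [abs_lt] at hn
      linarith
    refine tendsto_nhds_unique ?_ (hF (u n) (c n) (hc n))
    refine tendsto_const_nhds.congr' ?_
    filter_upwards [eventually_ge_atTop (r + 2)] with t ht
    rw [Function.comp_apply, (hR n).eq_of_le hRn (hRn.trans (ENNReal.coe_le_coe.2 ht))]
  | ideal ξ =>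
    have htr' := hc'.isTruncatedRay_ideal
    -- Each `c n` is cut at a time where `g` nearly attains `F (u n)`: its stopping time if that is
    -- finite, a late time otherwise.
    have ht : ∀ n, ∃ t : ℝ≥0, (t : ℝ≥0∞) ≤ R n ∧ min (n : ℝ≥0∞) (R n) ≤ t ∧
        dist (g (c n t)) (F (u n)) < 1 / ((n : ℝ) + 1) := by
      intro n
      have hpos : 0 < 1 / ((n : ℝ) + 1) := by positivity
      have hFn := (hF (u n) (c n) (hc n)).eventually (Metric.ball_mem_nhds _ hpos)
      rcases eq_or_ne (R n) ⊤ with htop | htop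
      · obtain ⟨t, ht, hnt⟩ := (hFn.and (eventually_ge_atTop (n : ℝ≥0))).exists
        refine ⟨t, by simp [htop], (min_le_left _ _).trans ?_, ht⟩
        exact_mod_cast hnt
      · lift R n to ℝ≥0 using htop with r hr
        obtain ⟨t, ht, hnt⟩ := (hFn.and (eventually_ge_atTop r)).exists
        refine ⟨r, le_rfl, min_le_right _ _, ?_⟩
        have hRn := hR n
        rw [← hr] at hRn
        rw [hRn.eq_of_le le_rfl (ENNReal.coe_le_coe.2 hnt)]
        exact ht
    choose t htR hnt hdist using ht
    -- If `c n` stopped before `T`, its position at time `T + 1` would be within `T` of the start;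
    -- but the limit ray is then at distance `T + 1`.
    have ht : Tendsto (fun n => (t n : ℝ)) atTop atTop := by
      refine tendsto_atTop.2 fun T => ?_
      have h1 := (hlim 0).dist (hlim (T.toNNReal + 1))
      rw [htr'.dist_eq le_top le_top] at h1
      have h2 : (T.toNNReal : ℝ) < |((0 : ℝ≥0) : ℝ) - (T.toNNReal + 1 : ℝ≥0)| := by
        push_cast
        rw [zero_sub, abs_neg, abs_of_nonneg (by positivity)]
        linarith
      filter_upwards [h1.eventually_const_lt h2, eventually_ge_atTop ⌈T⌉₊] with n hn hTn
      have hRn : (T.toNNReal : ℝ≥0∞) ≤ R n := by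
        by_contra hlt
        push Not at hlt
        have h3 := (hR n).eq_of_le (s := T.toNNReal + 1) (t := T.toNNReal)
          (hlt.le.trans (ENNReal.coe_le_coe.2 (by simp))) hlt.le
        have h4 := (hR n).lipschitzWith.dist_le_mul 0 T.toNNReal
        rw [h3] at hn
        rw [NNReal.dist_eq, NNReal.coe_zero, zero_sub, abs_neg, NNReal.abs_eq, NNReal.coe_one,
          one_mul] at h4
        linarith
      have h5 : (T.toNNReal : ℝ≥0∞) ≤ t n := by
        refine le_trans (le_min ?_ hRn) (hnt n)
        have : T.toNNReal ≤ (n : ℝ≥0) := by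
          rw [Real.toNNReal_le_iff_le_coe]
          exact (Nat.le_ceil T).trans (by exact_mod_cast hTn)
        exact_mod_cast this
      exact (Real.le_coe_toNNReal T).trans (by exact_mod_cast h5)
    have hq' : Tendsto (fun n => g (c n (t n))) atTop (𝓝 q) := by
      refine hq.congr_dist ?_
      refine squeeze_zero (fun _ => dist_nonneg) (fun n => ?_)
        tendsto_one_div_add_atTop_nhds_zero_nat
      rw [dist_comm]
      exact (hdist n).le
    have hA := hg.tendsto_of_tendsto_segments (c := fun n (s : ℝ) => c n s.toNNReal)
      (c' := fun s : ℝ => c' s.toNNReal) ht (fun n => (hR n).isGeodesicSegment (htR n))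
      (fun s _ => hlim _) (by simpa using hq')
    have hA' := hA.comp (NNReal.tendsto_coe_atTop.2 tendsto_id)
    exact tendsto_nhds_unique (by simpa [Function.comp_def] using hA') hFξ

end IsRadialExtension

lemma GromovCompactification.isClosed_iff {X : Type*} [PseudoEMetricSpace X] {o : X}
    {B : Set (GromovCompactification o)} :
    IsClosed B ↔ ∀ (u : ℕ → GromovCompactification o) (ξ : GromovCompactification o),
      (∀ n, u n ∈ B) → GromovConverges o u ξ → ξ ∈ B := by
  rw [← isOpen_compl_iff]
  change Bᶜᶜ ∈ _ ↔ _
  rw [compl_compl]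
  rfl

namespace IsRadialExtension

variable {X E : Type*} [MetricSpace X] [MetricSpace E] {g : X → E} {o : X}
  {F : GromovCompactification o → E}

/-- Closed sets are defined by sequences, so sequential continuity is enough. Compactness of
`closure (range g)` provides a subsequence along which `F (u n)` converges. -/
lemma continuous (hg : IsVisibleEmbedding g) (hF : IsRadialExtension g F)
    (hgeo : ∀ x y : X, ∃ (L : ℝ) (γ : ℝ → X), IsGeodesicSegment γ L ∧ γ 0 = x ∧ γ L = y) :
    Continuous F := by
  refine continuous_iff_isClosed.2 fun C hC => GromovCompactification.isClosed_iff.2 ?_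
  rintro u ξ hu ⟨c, hc, hsub⟩
  obtain ⟨q, -, τ, hτ, hq⟩ := hg.isCompact_closure.tendsto_subseq
    (x := fun n => F (u n)) fun n => hF.mem_closure hgeo (u n)
  obtain ⟨θ, hθ, c', hc', hlim⟩ := hsub τ hτ
  have h := hF.eq_of_tendsto hg (u := fun n => u (τ (θ n))) (fun n => hc (τ (θ n))) hc'
    (fun s => (hlim {s} isCompact_singleton).tendsto_at rfl) (hq.comp hθ.tendsto_atTop)
  rw [mem_preimage, ← h]
  exact hC.mem_of_tendsto hq (Eventually.of_forall fun n => hu _)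

/-- Given convergent values `F (u n)`, generalized rays to `u n` subconverge to a truncated ray. Its
end point is a Gromov limit of a subsequence of `u`, hence lies in `B`, and `F` takes the limit
value there. -/
lemma isClosedMap [ProperSpace X] (hg : IsVisibleEmbedding g) (hF : IsRadialExtension g F)
    (hgeo : ∀ x y : X, ∃ (L : ℝ) (γ : ℝ → X), IsGeodesicSegment γ L ∧ γ 0 = x ∧ γ L = y) :
    IsClosedMap F := by
  intro B hB
  rw [GromovCompactification.isClosed_iff] at hB
  refine IsSeqClosed.isClosed fun y q hy hq => ?_
  choose u hu hy using hy
  choose c hc using fun n => exists_isGeneralizedRay hgeo (u n)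
  choose R hR using fun n => (hc n).exists_isTruncatedRay
  obtain ⟨φ, hφ, c', R', hc', hlim⟩ := exists_subseq_tendsto_isTruncatedRay c R hR
  obtain ⟨ξ, hξ⟩ := hc'.exists_isGeneralizedRay
  refine ⟨ξ, hB (fun n => u (φ n)) ξ (fun n => hu _) ⟨fun n => c (φ n), fun n => hc _, ?_⟩, ?_⟩
  · intro τ hτ
    refine ⟨id, strictMono_id, c', hξ, fun K hK => ?_⟩
    intro s hs
    exact hτ.tendsto_atTop.eventually (hlim K hK s hs)
  · refine (hF.eq_of_tendsto hg (fun n => hc (φ n)) hξ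
      (fun s => (hlim {s} isCompact_singleton).tendsto_at rfl) ?_).symm
    simp only [hy]
    exact hq.comp hφ.tendsto_atTop

lemma range_eq [ProperSpace X] (hg : IsVisibleEmbedding g) (hF : IsRadialExtension g F)
    (hgeo : ∀ x y : X, ∃ (L : ℝ) (γ : ℝ → X), IsGeodesicSegment γ L ∧ γ 0 = x ∧ γ L = y) :
    range F = closure (range g) := by
  refine Subset.antisymm (range_subset_iff.2 (hF.mem_closure hgeo))
    (closure_minimal ?_ (hF.isClosedMap hg hgeo).isClosed_range)
  rintro _ ⟨x, rfl⟩
  exact ⟨.point x, hF.apply_point hgeo x⟩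

end IsRadialExtension

/-! ### Geodesic lines and injectivity -/

/-- In a hyperbolic space the segments between corresponding points of two rays that are not
equivalent stay within a bounded distance of the base point. -/
lemma IsGromovHyperbolic.exists_dist_le {X : Type*} [MetricSpace X] (h : IsGromovHyperbolic X)
    {o : X} {γ η : GeodesicRay o} (hne : ¬ ∃ C : ℝ≥0, ∀ t, edist (γ.toFun t) (η.toFun t) ≤ C) :
    ∃ D : ℝ, ∀ (T L : ℝ) (σ : ℝ → X), 0 ≤ T → IsGeodesicSegment σ L →
      σ 0 = γ.toFun T.toNNReal → σ L = η.toFun T.toNNReal → ∃ s ∈ Icc (0 : ℝ) L, dist o (σ s) ≤ D := by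
  obtain ⟨δ, hδ⟩ := h
  push Not at hne
  -- Thinness is applied at `γ t₀`. If this point is `δ`-close to some `η s`, then `|s - t₀| ≤ δ`
  -- and `γ t₀`, `η t₀` are within `2 * δ`, which is excluded; so it is `δ`-close to `σ`, whence the
  -- bound `t₀ + δ`.
  obtain ⟨t₀, ht₀⟩ := hne (2 * δ)
  refine ⟨t₀ + δ, fun T L σ hT hσ h0 hL => ?_⟩
  have hseg : ∀ ζ : GeodesicRay o, IsGeodesicSegment (fun s : ℝ => ζ.toFun s.toNNReal) T := by
    intro ζ
    have := ζ.isTruncatedRay.isGeodesicSegment (T := T.toNNReal) le_top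
    rwa [Real.coe_toNNReal _ hT] at this
  rcases lt_or_ge T (t₀ : ℝ) with hTt | hTt
  · refine ⟨0, ⟨le_rfl, hσ.1⟩, ?_⟩
    rw [h0, γ.dist_start, Real.coe_toNNReal _ hT]
    linarith [δ.2]
  obtain ⟨s, hs, hd⟩ | ⟨s, hs, hd⟩ := hδ T L T _ σ _ (hseg γ) hσ (hseg η)
    (by simp [γ.start, η.start]) h0.symm hL t₀ ⟨t₀.2, hTt⟩
  · refine ⟨s, hs, ?_⟩
    rw [Real.toNNReal_coe, edist_dist, ENNReal.ofReal_le_iff_le_toReal ENNReal.coe_ne_top,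
      ENNReal.coe_toReal] at hd
    have := dist_triangle o (γ.toFun t₀) (σ s)
    rw [γ.dist_start] at this
    linarith
  · exfalso
    rw [Real.toNNReal_coe, edist_dist, ENNReal.ofReal_le_iff_le_toReal ENNReal.coe_ne_top,
      ENNReal.coe_toReal] at hd
    have h1 := dist_triangle o (γ.toFun t₀) (η.toFun s.toNNReal)
    have h2 := dist_triangle o (η.toFun s.toNNReal) (γ.toFun t₀)
    rw [dist_comm (η.toFun _)] at h2
    rw [γ.dist_start, η.dist_start, Real.coe_toNNReal _ hs.1] at h1 h2
    have h3 : dist (η.toFun s.toNNReal) (η.toFun t₀) ≤ δ := by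
      rw [η.isometry.dist_eq, NNReal.dist_eq, Real.coe_toNNReal _ hs.1, abs_le]
      constructor <;> linarith
    have h4 := dist_triangle (γ.toFun t₀) (η.toFun s.toNNReal) (η.toFun t₀)
    refine absurd ht₀ (not_lt.2 ?_)
    rw [edist_dist, ENNReal.ofReal_le_iff_le_toReal ENNReal.coe_ne_top, ENNReal.coe_toReal]
    push_cast
    linarith

/-- Two rays that are not equivalent, and whose images under a visible embedding converge, are
joined by a geodesic line with the same limits. -/
lemma IsVisibleEmbedding.exists_line {X E : Type*} [MetricSpace X] [ProperSpace X] [MetricSpace E]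
    {g : X → E} (hg : IsVisibleEmbedding g) (h : IsGromovHyperbolic X)
    (hgeo : ∀ x y : X, ∃ (L : ℝ) (γ : ℝ → X), IsGeodesicSegment γ L ∧ γ 0 = x ∧ γ L = y)
    {o : X} {γ η : GeodesicRay o} (hne : ¬ ∃ C : ℝ≥0, ∀ t, edist (γ.toFun t) (η.toFun t) ≤ C)
    {p q : E} (hp : Tendsto (fun t => g (γ.toFun t)) atTop (𝓝 p))
    (hq : Tendsto (fun t => g (η.toFun t)) atTop (𝓝 q)) :
    ∃ σ : ℝ → X, Isometry σ ∧ Tendsto (fun t => g (σ t)) atBot (𝓝 p) ∧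
      Tendsto (fun t => g (σ t)) atTop (𝓝 q) := by
  obtain ⟨D, hD⟩ := h.exists_dist_le hne
  choose L σ hσ h0 hL using fun n : ℕ => hgeo (γ.toFun (n : ℝ≥0)) (η.toFun (n : ℝ≥0))
  have hs := fun n : ℕ => hD n (L n) (σ n) n.cast_nonneg (hσ n) (by simpa using h0 n)
    (by simpa using hL n)
  choose a ha hoa using hs
  simp only [isGeodesicSegment_iff_dist] at hσ
  have hleft : ∀ n : ℕ, (n : ℝ) - D ≤ a n := by
    intro n
    have h1 := (hσ n).2 0 ⟨le_rfl, (hσ n).1⟩ (a n) (ha n)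
    rw [zero_sub, abs_neg, abs_of_nonneg (ha n).1, h0] at h1
    have h2 := dist_triangle o (σ n (a n)) (γ.toFun (n : ℝ≥0))
    rw [γ.dist_start, dist_comm (σ n (a n))] at h2
    have := hoa n
    push_cast at h2
    linarith
  have hright : ∀ n : ℕ, (n : ℝ) - D ≤ L n - a n := by
    intro n
    have h1 := (hσ n).2 (a n) (ha n) (L n) ⟨(hσ n).1, le_rfl⟩
    rw [abs_sub_comm, abs_of_nonneg (by linarith [(ha n).2]), hL] at h1
    have h2 := dist_triangle o (σ n (a n)) (η.toFun (n : ℝ≥0))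
    rw [η.dist_start] at h2
    have := hoa n
    push_cast at h2
    linarith
  set l : Ultrafilter ℕ := hyperfilter ℕ
  have hl : (l : Filter ℕ) ≤ atTop := Nat.hyperfilter_le_atTop
  have htend : Tendsto (fun n : ℕ => (n : ℝ) - D) l atTop :=
    (tendsto_atTop_add_const_right _ (-D) tendsto_natCast_atTop_atTop).mono_left hl
  have htl : Tendsto a l atTop := tendsto_atTop_mono hleft htend
  have htr : Tendsto (fun n => L n - a n) l atTop := tendsto_atTop_mono hright htend
  -- Each segment is shifted so that its point near `o` has parameter 0, and clamped at its ends to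
  -- be defined on `ℝ`. Both halves have length at least `n - D`, so at any two fixed times the
  -- clamping eventually disappears and the limit is isometric.
  set c : ℕ → ℝ → X := fun n t => σ n (max 0 (min (L n) (a n + t))) with hc
  have hin : ∀ n t, max 0 (min (L n) (a n + t)) ∈ Icc (0 : ℝ) (L n) := fun n t =>
    ⟨le_max_left _ _, max_le (hσ n).1 (min_le_left _ _)⟩
  have heq : ∀ n t, -a n ≤ t → t ≤ L n - a n → max 0 (min (L n) (a n + t)) = a n + t := by
    intro n t h1 h2
    rw [min_eq_right (by linarith), max_eq_right (by linarith)]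
  have hdist : ∀ n s t, -a n ≤ s → s ≤ L n - a n → -a n ≤ t → t ≤ L n - a n →
      dist (c n s) (c n t) = |s - t| := by
    intro n s t hs1 hs2 ht1 ht2
    rw [hc]
    dsimp only
    rw [(hσ n).2 _ (hin n s) _ (hin n t), heq n s hs1 hs2, heq n t ht1 ht2,
      add_sub_add_left_eq_sub]
  have hc0 : ∀ n, c n 0 = σ n (a n) := by
    intro n
    rw [hc]
    dsimp only
    rw [heq n 0 (by linarith [(ha n).1]) (by linarith [(ha n).2]), add_zero]
  have hbound : ∀ t n, dist (c n t) o ≤ |t| + D := by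
    intro t n
    have h1 : dist (c n t) (c n 0) ≤ |t| := by
      rw [hc]
      dsimp only
      rw [(hσ n).2 _ (hin n t) _ (hin n 0)]
      refine (abs_max_sub_max_le_max _ _ _ _).trans (max_le (by simp) ?_)
      exact (abs_min_sub_min_le_max _ _ _ _).trans (by simp)
    have h2 := dist_triangle (c n t) (c n 0) o
    have h3 := hoa n
    rw [dist_comm, ← hc0] at h3
    linarith
  choose τ hτ using fun t => l.exists_tendsto_of_dist_le (fun n => c n t) o _ (hbound t)
  refine ⟨τ, Isometry.of_dist_eq fun s t => ?_, ?_, ?_⟩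
  · refine tendsto_nhds_unique ((hτ s).dist (hτ t)) (tendsto_const_nhds.congr' ?_)
    filter_upwards [htl.eventually_ge_atTop (max (-s) (-t)), htr.eventually_ge_atTop (max s t)]
      with n h1 h2
    rw [max_le_iff] at h1 h2
    rw [hdist n s t (by linarith) h2.1 (by linarith) h2.2, Real.dist_eq]
  -- The left half, traversed backwards, is a segment ending at `γ n`, so the line inherits the
  -- limit `p`. The right half, ending at `η n`, gives `q`.
  · have hA := hg.tendsto_of_tendsto_segments (l := (l : Filter ℕ)) (c := fun n t => c n (-t))
      (c' := fun t => τ (-t)) (q := p) htl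
      (fun n => isGeodesicSegment_iff_dist.2 ⟨(ha n).1, fun s hs t ht => by
        rw [hdist n (-s) (-t) (by linarith [hs.2]) (by linarith [hs.1, (ha n).2])
          (by linarith [ht.2]) (by linarith [ht.1, (ha n).2]), neg_sub_neg, abs_sub_comm]⟩)
      (fun s _ => hτ (-s)) (by
        have : ∀ n, c n (-a n) = γ.toFun (n : ℝ≥0) := by
          intro n
          rw [hc]
          dsimp only
          rw [heq n _ le_rfl (by linarith [(ha n).1, (ha n).2]), add_neg_cancel, h0]
        simp only [this]
        exact (hp.comp tendsto_natCast_atTop_atTop).mono_left hl)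
    simpa [Function.comp_def] using hA.comp tendsto_neg_atBot_atTop
  · refine hg.tendsto_of_tendsto_segments (l := (l : Filter ℕ)) (c := c) (c' := τ) htr
      (fun n => isGeodesicSegment_iff_dist.2 ⟨by linarith [(ha n).2], fun s hs t ht =>
        hdist n s t (by linarith [hs.1, (ha n).1]) hs.2 (by linarith [ht.1, (ha n).1]) ht.2⟩)
      (fun s _ => hτ s) ?_
    have : ∀ n, c n (L n - a n) = η.toFun (n : ℝ≥0) := by
      intro n
      rw [hc]
      dsimp only
      rw [heq n _ (by linarith [(hσ n).1]) le_rfl, add_sub_cancel, hL]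
    simp only [this]
    exact (hq.comp tendsto_natCast_atTop_atTop).mono_left hl

lemma setOf_mapClusterPt_of_tendsto {α E : Type*} [TopologicalSpace E] [T2Space E] {l : Filter α}
    [l.NeBot] {u : α → E} {p : E} (h : Tendsto u l (𝓝 p)) : {x | MapClusterPt x l u} = {p} := by
  ext x
  refine ⟨fun hx => ?_, ?_⟩
  · obtain ⟨v, hv, hvx⟩ := mapClusterPt_iff_ultrafilter.1 hx
    exact tendsto_nhds_unique hvx (h.mono_left hv)
  · rintro rfl
    exact h.mapClusterPt

/-- Ideal points land outside `range g`, where `g` is injective, so only two ideal points can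
collide; `exists_line` turns such a collision into a loop. -/
lemma IsRadialExtension.injective {X E : Type*} [MetricSpace X] [ProperSpace X] [MetricSpace E]
    {g : X → E} {o : X} {F : GromovCompactification o → E} (hg : IsVisibleEmbedding g)
    (hF : IsRadialExtension g F) (h : IsGromovHyperbolic X)
    (hgeo : ∀ x y : X, ∃ (L : ℝ) (γ : ℝ → X), IsGeodesicSegment γ L ∧ γ 0 = x ∧ γ L = y)
    (hloop : ¬ ∃ σ : ℝ → X, Isometry σ ∧ {p | MapClusterPt p atTop fun t => g (σ t)} =
      {p | MapClusterPt p atBot fun t => g (σ t)}) : Function.Injective F := by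
  have hideal : ∀ γ : GeodesicRay o, F (.ideal (Quotient.mk _ γ)) ∉ range g := fun γ =>
    (hg.notMem_range_of_tendsto_geodesicRay γ (hF.tendsto_mk γ)).2
  rintro (x | ξ) (y | ζ) heq
  · rw [hF.apply_point hgeo, hF.apply_point hgeo] at heq
    rw [hg.isEmbedding.injective heq]
  · obtain ⟨η, rfl⟩ := Quotient.exists_rep ζ
    exact absurd ⟨x, by rw [← heq, hF.apply_point hgeo]⟩ (hideal η)
  · obtain ⟨γ, rfl⟩ := Quotient.exists_rep ξ
    exact absurd ⟨y, by rw [heq, hF.apply_point hgeo]⟩ (hideal γ)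
  · obtain ⟨γ, rfl⟩ := Quotient.exists_rep ξ
    obtain ⟨η, rfl⟩ := Quotient.exists_rep ζ
    congr 1
    refine Quotient.sound ?_
    by_contra hne
    obtain ⟨σ, hσ, hbot, htop⟩ := hg.exists_line h hgeo hne (hF.tendsto_mk γ) (hF.tendsto_mk η)
    refine hloop ⟨σ, hσ, ?_⟩
    rw [setOf_mapClusterPt_of_tendsto hbot, setOf_mapClusterPt_of_tendsto htop, heq]

/-! ### The Kobayashi distance of a bounded submanifold -/

/-- From `log x ≥ 1 - 1 / x` at `x = (1 + r) / (1 - r)`, since `2 * r / (1 + r) ≥ r`. The factor 2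
is not sharp, but any constant serves for a Lipschitz bound. -/
lemma Real.le_two_mul_artanh {r : ℝ} (h0 : 0 ≤ r) (h1 : r < 1) : r ≤ 2 * Real.artanh r := by
  rw [Real.artanh_eq_half_log ⟨by linarith, h1.le⟩, ← mul_assoc, mul_one_div_cancel two_ne_zero,
    one_mul]
  refine le_trans ?_ (Real.one_sub_inv_le_log_of_pos (div_pos (by linarith) (by linarith)))
  rw [inv_div, le_sub_iff_add_le, ← le_sub_iff_add_le', div_le_iff₀ (by linarith)]
  nlinarith

/-- Poincaré length is additive along a radius; this is what allows a disc to be cut at a prescribed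
length. -/
lemma Real.artanh_sub_artanh {c r : ℝ} (hc0 : 0 ≤ c) (hcr : c ≤ r) (hr : r < 1) :
    Real.artanh r - Real.artanh c = Real.artanh ((r - c) / (1 - c * r)) := by
  have hcr1 : c * r < 1 := by nlinarith
  have h1 : 0 < 1 - c * r := by linarith
  have h2 : 0 < 1 - c := by linarith
  have h3 : 0 < 1 - r := by linarith
  have hq0 : 0 ≤ (r - c) / (1 - c * r) := div_nonneg (by linarith) h1.le
  have hq1 : (r - c) / (1 - c * r) ≤ 1 := by rw [div_le_one h1]; nlinarith
  rw [Real.artanh_eq_half_log ⟨by linarith, hr.le⟩, Real.artanh_eq_half_log ⟨by linarith, by linarith⟩,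
    Real.artanh_eq_half_log ⟨by linarith, hq1⟩, ← mul_sub,
    ← Real.log_div (div_pos (by linarith) h3).ne' (div_pos (by linarith) h2).ne']
  congr 2
  have h4 : 1 - (r - c) / (1 - c * r) = (1 - r) * (1 + c) / (1 - c * r) := by
    rw [eq_div_iff h1.ne', sub_mul, div_mul_cancel₀ _ h1.ne']
    ring
  have h5 : 1 + (r - c) / (1 - c * r) = (1 + r) * (1 - c) / (1 - c * r) := by
    rw [eq_div_iff h1.ne', add_mul, div_mul_cancel₀ _ h1.ne']
    ring
  rw [h4, h5, div_div_div_cancel_right₀ h1.ne', div_div_div_eq]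

/-- The difference of the squares is `(1 - |a|²) * (1 - |z|²)`. -/
lemma norm_add_lt_norm_one_add_conj_mul {a z : ℂ} (ha : ‖a‖ < 1) (hz : ‖z‖ < 1) :
    ‖a + z‖ < ‖1 + (starRingEnd ℂ) a * z‖ := by
  rw [← sq_lt_sq₀ (norm_nonneg _) (norm_nonneg _), ← Complex.normSq_eq_norm_sq,
    ← Complex.normSq_eq_norm_sq]
  have ha' : Complex.normSq a < 1 := by
    rw [Complex.normSq_eq_norm_sq]; nlinarith [norm_nonneg a]
  have hz' : Complex.normSq z < 1 := by
    rw [Complex.normSq_eq_norm_sq]; nlinarith [norm_nonneg z]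
  simp only [Complex.normSq_apply, Complex.add_re, Complex.add_im, Complex.mul_re, Complex.mul_im,
    Complex.one_re, Complex.one_im, Complex.conj_re, Complex.conj_im] at *
  nlinarith [mul_pos (sub_pos.2 ha') (sub_pos.2 hz')]

lemma poincareDist_ofReal {c r : ℝ} (hc0 : 0 ≤ c) (hcr : c ≤ r) (hr : r < 1) :
    poincareDist c r = Real.artanh r - Real.artanh c := by
  have h1 : 0 < 1 - c * r := by nlinarith
  rw [Real.artanh_sub_artanh hc0 hcr hr, poincareDist, Complex.conj_ofReal]
  congr 1
  rw [← Complex.ofReal_mul, ← Complex.ofReal_one, ← Complex.ofReal_sub, ← Complex.ofReal_sub,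
    ← Complex.ofReal_div, Complex.norm_real, Real.norm_eq_abs, ← abs_neg, ← neg_div, neg_sub,
    abs_of_nonneg (div_nonneg (by linarith) h1.le)]

/-- Every two points of a holomorphic disc are the images of `0` and of a point `r ∈ [0, 1)` under
another holomorphic disc, with the same Poincaré distance. -/
lemma IsHolomorphicDisc.exists_normalized {d : ℕ} {M : Set (CSpace d)} {φ : ℂ → CSpace d}
    (hφ : IsHolomorphicDisc M φ) {a b : ℂ} (ha : a ∈ Metric.ball (0 : ℂ) 1)
    (hb : b ∈ Metric.ball (0 : ℂ) 1) :
    ∃ (ψ : ℂ → CSpace d) (r : ℝ), IsHolomorphicDisc M ψ ∧ 0 ≤ r ∧ r < 1 ∧ ψ 0 = φ a ∧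
      ψ r = φ b ∧ poincareDist a b = Real.artanh r := by
  rw [mem_ball_zero_iff] at ha hb
  have hne : ∀ z : ℂ, ‖z‖ < 1 → 1 + (starRingEnd ℂ) a * z ≠ 0 := fun z hz h0 => by
    have := norm_add_lt_norm_one_add_conj_mul ha hz
    rw [h0, norm_zero] at this
    exact absurd this (not_lt.2 (norm_nonneg _))
  -- The image of `b` under the disc automorphism that takes `a` to 0; the unimodular `u` below
  -- rotates `‖w‖` to `w`.
  set w : ℂ := (b - a) / (1 - (starRingEnd ℂ) a * b) with hw
  have hden : 1 - (starRingEnd ℂ) a * b ≠ 0 := by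
    have := hne (-b) (by rwa [norm_neg])
    rwa [mul_neg, ← sub_eq_add_neg] at this
  have hw1 : ‖w‖ < 1 := by
    rw [hw, norm_div, div_lt_one (norm_pos_iff.2 hden)]
    have := norm_add_lt_norm_one_add_conj_mul (a := -a) (z := b) (by rwa [norm_neg]) hb
    rwa [map_neg, neg_mul, ← sub_eq_add_neg, add_comm, ← sub_eq_add_neg] at this
  obtain ⟨u, hu, huw⟩ : ∃ u : ℂ, ‖u‖ = 1 ∧ u * (‖w‖ : ℂ) = w := by
    rcases eq_or_ne w 0 with h0 | h0
    · exact ⟨1, norm_one, by simp [h0]⟩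
    · have hn : (‖w‖ : ℂ) ≠ 0 := by exact_mod_cast norm_ne_zero_iff.2 h0
      exact ⟨w / ‖w‖, by simp [h0], div_mul_cancel₀ _ hn⟩
  have hnorm : ∀ z ∈ Metric.ball (0 : ℂ) 1, ‖u * z‖ < 1 := fun z hz => by
    rwa [norm_mul, hu, one_mul, ← mem_ball_zero_iff]
  -- The inverse automorphism preceded by the rotation: it takes 0 to `a` and `‖w‖` to `b`.
  set m : ℂ → ℂ := fun z => (a + u * z) / (1 + (starRingEnd ℂ) a * (u * z)) with hm
  have hmaps : MapsTo m (Metric.ball 0 1) (Metric.ball 0 1) := fun z hz => by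
    rw [mem_ball_zero_iff, hm, norm_div, div_lt_one (norm_pos_iff.2 (hne _ (hnorm z hz)))]
    exact norm_add_lt_norm_one_add_conj_mul ha (hnorm z hz)
  have hdiff : DifferentiableOn ℂ m (Metric.ball 0 1) := by
    refine DifferentiableOn.div ?_ ?_ fun z hz => hne _ (hnorm z hz)
    · fun_prop
    · fun_prop
  refine ⟨φ ∘ m, ‖w‖, ⟨hφ.1.comp hdiff hmaps, hφ.2.comp hmaps⟩, norm_nonneg _, hw1, ?_, ?_, ?_⟩
  · simp [hm]
  · have hmw : m ‖w‖ = b := by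
      have h1 := hne w hw1
      rw [hm]
      dsimp only
      have hw' : w * (1 - (starRingEnd ℂ) a * b) = b - a := div_mul_cancel₀ _ hden
      rw [huw, div_eq_iff h1]
      linear_combination hw'
    rw [Function.comp_apply, hmw]
  · rw [poincareDist, hw, norm_div, norm_div, norm_sub_rev]

section

variable {d : ℕ} {M : Set (CSpace d)}

/-- The Schwarz lemma for chains of discs. -/
lemma KobayashiChain.edist_le {C : ℝ≥0} (hC : ∀ x ∈ M, ∀ y ∈ M, dist x y ≤ C) {z w : CSpace d}
    {r : ℝ≥0∞} (h : KobayashiChain M z w r) : edist z w ≤ (2 * C : ℝ≥0) * r := by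
  induction h with
  | refl _ => simp
  | snoc s φ hφ a b ha hb _ ih =>
    rw [mul_add]
    refine (edist_triangle _ (φ a) _).trans (add_le_add ih ?_)
    obtain ⟨ψ, r, hψ, hr0, hr1, h0, hr, hP⟩ := hφ.exists_normalized ha hb
    have h0mem : (0 : ℂ) ∈ Metric.ball (0 : ℂ) 1 := Metric.mem_ball_self one_pos
    have hrmem : (r : ℂ) ∈ Metric.ball (0 : ℂ) 1 := by
      rwa [mem_ball_zero_iff, Complex.norm_real, Real.norm_of_nonneg hr0]
    have hS := Complex.dist_le_div_mul_dist_of_mapsTo_ball (R₂ := (C : ℝ)) hψ.1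
      (fun z hz => hC _ (hψ.2 hz) _ (hψ.2 h0mem)) hrmem
    rw [div_one, dist_zero_right, Complex.norm_real, Real.norm_of_nonneg hr0, dist_comm] at hS
    rw [← h0, ← hr, hP, edist_dist, ← ENNReal.ofReal_coe_nnreal, ← ENNReal.ofReal_mul NNReal.zero_le_coe]
    refine ENNReal.ofReal_le_ofReal (hS.trans ?_)
    push_cast
    nlinarith [Real.le_two_mul_artanh hr0 hr1, C.2, mul_le_mul_of_nonneg_left
      (Real.le_two_mul_artanh hr0 hr1) C.2]

/-- A chain of discs can be cut at any length. -/
lemma KobayashiChain.exists_between {x y : CSpace d} {r : ℝ≥0∞} (h : KobayashiChain M x y r) :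
    ∀ s t : ℝ≥0∞, r ≤ s + t → ∃ z ∈ M, kobayashiEDist M x z ≤ s ∧ kobayashiEDist M z y ≤ t := by
  induction h with
  | refl hz => exact fun s t _ => ⟨x, hz, by simp [kobayashiEDist_self hz]⟩
  | snoc r φ hφ a b ha hb hch ih =>
    intro s t hst
    -- Either the cut falls in the earlier chain, where induction applies, or it falls in or beyond
    -- the last disc.
    rcases le_total s r with hsr | hrs
    · obtain ⟨r', rfl⟩ := exists_add_of_le hsr
      rcases eq_or_ne s ⊤ with rfl | hs
      · exact ⟨φ b, hφ.2 hb, le_top, by simp [kobayashiEDist_self (hφ.2 hb)]⟩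
      obtain ⟨z, hz, h1, h2⟩ := ih s r' le_rfl
      refine ⟨z, hz, h1, ?_⟩
      rw [add_assoc, ENNReal.add_le_add_iff_left hs] at hst
      refine (kobayashiEDist_triangle M z (φ a) (φ b)).trans (le_trans (add_le_add h2 ?_) hst)
      have := KobayashiChain.snoc 0 φ hφ a b ha hb (.refl (hφ.2 ha))
      rw [zero_add] at this
      exact sInf_le this
    · obtain ⟨s', rfl⟩ := exists_add_of_le hrs
      rcases eq_or_ne r ⊤ with rfl | hr
      · exact ⟨φ b, hφ.2 hb, by simp, by simp [kobayashiEDist_self (hφ.2 hb)]⟩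
      rw [add_assoc, ENNReal.add_le_add_iff_left hr] at hst
      obtain ⟨ψ, R, hψ, hR0, hR1, h0, hR, hP⟩ := hφ.exists_normalized ha hb
      rcases le_or_gt (ENNReal.ofReal (poincareDist a b)) s' with hle | hlt
      · refine ⟨φ b, hφ.2 hb, ?_, by simp [kobayashiEDist_self (hφ.2 hb)]⟩
        exact (sInf_le (KobayashiChain.snoc r φ hφ a b ha hb hch)).trans (add_le_add le_rfl hle)
      lift s' to ℝ≥0 using hlt.ne_top
      rw [hP] at hst hlt
      rw [ENNReal.lt_ofReal_iff_toReal_lt ENNReal.coe_ne_top, ENNReal.coe_toReal] at hlt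
      -- On the normalized disc, the point of the radius at Poincaré distance `s'` from 0; the
      -- length left over is `artanh R - s'`.
      set c := Real.tanh s' with hc
      have hc1 : c < 1 := Real.tanh_lt_one _
      have hcm : -1 < c := Real.neg_one_lt_tanh _
      have hca : Real.artanh c = s' := Real.artanh_tanh _
      have hc0 : 0 ≤ c := by
        rw [← Real.artanh_le_artanh_iff (by norm_num) ⟨hcm, hc1⟩, hca, Real.artanh_zero]
        exact s'.2
      have hcR : c < R := by
        rw [← Real.artanh_lt_artanh_iff ⟨hcm, hc1⟩ ⟨by linarith, hR1⟩, hca]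
        exact hlt
      have hmem : ∀ q : ℝ, 0 ≤ q → q < 1 → (q : ℂ) ∈ Metric.ball (0 : ℂ) 1 := fun q hq0 hq1 => by
        rwa [mem_ball_zero_iff, Complex.norm_real, Real.norm_of_nonneg hq0]
      have h0mem : (0 : ℂ) ∈ Metric.ball (0 : ℂ) 1 := Metric.mem_ball_self one_pos
      refine ⟨ψ c, hψ.2 (hmem c hc0 hc1), ?_, ?_⟩
      · rw [← h0] at hch
        have h1 := KobayashiChain.snoc r ψ hψ 0 c h0mem (hmem c hc0 hc1) hch
        rw [← Complex.ofReal_zero, poincareDist_ofReal le_rfl hc0 hc1, Real.artanh_zero, sub_zero,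
          hca, ENNReal.ofReal_coe_nnreal] at h1
        exact sInf_le h1
      · have h1 := KobayashiChain.snoc 0 ψ hψ c R (hmem c hc0 hc1) (hmem R hR0 hR1)
          (.refl (hψ.2 (hmem c hc0 hc1)))
        rw [poincareDist_ofReal hc0 hcR.le hR1, hca, zero_add, hR] at h1
        refine (sInf_le h1).trans ?_
        rw [ENNReal.ofReal_sub _ (NNReal.coe_nonneg s'), ENNReal.ofReal_coe_nnreal]
        exact tsub_le_iff_left.2 hst

/-- Points of a submanifold that are close in the ambient space are close for the Kobayashi
distance. -/
lemma IsEmbeddedComplexSubmanifold.eventually_kobayashiEDist_le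
    (hM : IsEmbeddedComplexSubmanifold M) {p : CSpace d} (hp : p ∈ M) {ε : ℝ} (hε : 0 < ε) :
    ∀ᶠ x in 𝓝 p, x ∈ M → kobayashiEDist M p x ≤ ENNReal.ofReal ε := by
  obtain ⟨φ, hps, hφ, hφs, L, hL⟩ := hM p hp
  obtain ⟨ρ, hρ, hball⟩ := Metric.isOpen_iff.1 φ.open_target _ (φ.map_source hps)
  -- The linear disc `ℓ` passes through `φ p` at 0 and `φ x` at `s`, hence gives a chain of length
  -- `artanh s = ε`. It stretches `φ x - φ p` by up to `1 / s`, so closeness `s * ρ` keeps it in the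
  -- ball of radius `ρ`.
  set s := Real.tanh ε with hs
  have hs1 : s < 1 := Real.tanh_lt_one _
  have hs0 : 0 < s := by
    rw [← Real.artanh_lt_artanh_iff (by norm_num) ⟨Real.neg_one_lt_tanh _, hs1⟩,
      Real.artanh_tanh, Real.artanh_zero]
    exact hε
  have hnear : ∀ᶠ x in 𝓝 p, φ x ∈ Metric.ball (φ p) (s * ρ) :=
    (φ.continuousAt hps).eventually (Metric.ball_mem_nhds _ (by positivity))
  filter_upwards [hnear, φ.open_source.mem_nhds hps] with x hx hxs hxM
  have hmemL : ∀ y ∈ M, y ∈ φ.source → φ y ∈ L := fun y hy hys =>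
    (hL.subset (mem_image_of_mem φ ⟨hy, hys⟩)).1
  set v := φ x - φ p with hv
  have hvL : v ∈ L := L.sub_mem (hmemL x hxM hxs) (hmemL p hp hps)
  have hvn : ‖v‖ < s * ρ := by rwa [hv, ← dist_eq_norm]
  set ℓ : ℂ → CSpace d := fun z => φ p + (z / s) • v with hℓ
  have hℓt : MapsTo ℓ (Metric.ball 0 1) φ.target := by
    intro z hz
    rw [mem_ball_zero_iff] at hz
    refine hball ?_
    rw [Metric.mem_ball, hℓ, dist_eq_norm, add_sub_cancel_left, norm_smul, norm_div,
      Complex.norm_real, Real.norm_of_nonneg hs0.le, div_mul_eq_mul_div, div_lt_iff₀ hs0]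
    nlinarith [norm_nonneg v, norm_nonneg z]
  have hdisc : IsHolomorphicDisc M (φ.symm ∘ ℓ) := by
    refine ⟨hφs.comp (by fun_prop) hℓt, fun z hz => ?_⟩
    have hmem : ℓ z ∈ φ '' (M ∩ φ.source) := by
      rw [hL]
      exact ⟨L.add_mem (hmemL p hp hps) (L.smul_mem _ hvL), hℓt hz⟩
    obtain ⟨y, ⟨hyM, hys⟩, hy⟩ := hmem
    rw [Function.comp_apply, ← hy, φ.left_inv hys]
    exact hyM
  have h0 : (φ.symm ∘ ℓ) ((0 : ℝ) : ℂ) = p := by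
    simp [hℓ, φ.left_inv hps]
  have hsx : (φ.symm ∘ ℓ) (s : ℂ) = x := by
    have : (s : ℂ) ≠ 0 := by exact_mod_cast hs0.ne'
    simp [hℓ, hv, this, φ.left_inv hxs]
  have hch := KobayashiChain.snoc 0 _ hdisc ((0 : ℝ) : ℂ) (s : ℂ) (by simp)
    (by rwa [mem_ball_zero_iff, Complex.norm_real, Real.norm_of_nonneg hs0.le])
    (.refl (hdisc.2 (by simp)))
  rw [h0, hsx, poincareDist_ofReal le_rfl hs0.le hs1, Real.artanh_zero, sub_zero,
    Real.artanh_tanh, zero_add] at hch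
  exact sInf_le hch

/-- In a chart `M` is a piece of a linear subspace, which is closed because the dimension is finite.
-/
lemma IsEmbeddedComplexSubmanifold.isLocallyClosed (hM : IsEmbeddedComplexSubmanifold M) :
    IsLocallyClosed M := by
  refine ((isLocallyClosed_tfae M).out 0 3).2 fun p hp => ?_
  obtain ⟨φ, hps, -, -, L, hL⟩ := hM p hp
  refine ⟨φ.source, hps, φ.open_source, ?_⟩
  rintro y ⟨hys, hy⟩
  have h1 : y ∈ closure (φ.source ∩ M) := φ.open_source.inter_closure ⟨hys, hy⟩
  have h2 : φ y ∈ closure (φ '' (M ∩ φ.source)) := by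
    rw [inter_comm] at h1
    exact (φ.continuousAt hys).continuousWithinAt.mem_closure_image h1
  have h3 : φ y ∈ (L : Set (CSpace d)) := by
    refine closure_minimal ?_ L.closed_of_finiteDimensional h2
    rw [hL]
    exact inter_subset_left
  obtain ⟨x, ⟨hxM, hxs⟩, hxy⟩ := hL.superset ⟨h3, φ.map_source hys⟩
  rwa [← φ.injOn hxs hys hxy]

lemma KobayashiSpace.range_val : range (KobayashiSpace.val : KobayashiSpace M → CSpace d) = M :=
  Subset.antisymm (range_subset_iff.2 fun x => x.mem) fun x hx => ⟨⟨x, hx⟩, rfl⟩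

lemma KobayashiSpace.val_injective :
    Function.Injective (KobayashiSpace.val : KobayashiSpace M → CSpace d) := by
  rintro ⟨x, _⟩ ⟨y, _⟩ rfl
  rfl

lemma IsBddConnSubmanifold.exists_lipschitzWith (hM : IsBddConnSubmanifold M) :
    ∃ C : ℝ≥0, LipschitzWith C (KobayashiSpace.val : KobayashiSpace M → CSpace d) := by
  obtain ⟨C, hC⟩ := Metric.isBounded_iff.1 hM.bounded
  refine ⟨2 * (C.toNNReal + 1), fun x y => ?_⟩
  have hne : ((2 * (C.toNNReal + 1) : ℝ≥0) : ℝ≥0∞) ≠ 0 := by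
    rw [ENNReal.coe_ne_zero]
    positivity
  rw [mul_comm, ← ENNReal.div_le_iff_le_mul (.inl hne) (.inl ENNReal.coe_ne_top)]
  refine le_sInf fun r hr => ?_
  rw [ENNReal.div_le_iff_le_mul (.inl hne) (.inl ENNReal.coe_ne_top), mul_comm]
  refine KobayashiChain.edist_le (fun a ha b hb => (hC ha hb).trans ?_) hr
  push_cast
  linarith [Real.le_coe_toNNReal C]

/-- On a bounded submanifold the Kobayashi distance defines the topology of the ambient space. -/
lemma IsBddConnSubmanifold.isEmbedding_val (hM : IsBddConnSubmanifold M) :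
    IsEmbedding (KobayashiSpace.val : KobayashiSpace M → CSpace d) := by
  obtain ⟨C, hC⟩ := hM.exists_lipschitzWith
  refine ⟨isInducing_iff_nhds.2 fun x => le_antisymm (hC.continuous.tendsto x).le_comap ?_,
    KobayashiSpace.val_injective⟩
  intro s hs
  obtain ⟨ε, hε, hsub⟩ := EMetric.mem_nhds_iff.1 hs
  obtain ⟨δ, hδ0, hδ⟩ := ENNReal.lt_iff_exists_nnreal_btwn.1 hε
  have h := hM.embedded.eventually_kobayashiEDist_le x.mem
    (ε := δ) (by exact_mod_cast hδ0)
  refine mem_comap.2 ⟨_, h, fun y hy => hsub ?_⟩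
  have h1 : kobayashiEDist M x.val y.val ≤ ENNReal.ofReal δ := hy y.mem
  rw [ENNReal.ofReal_coe_nnreal, kobayashiEDist_comm] at h1
  exact lt_of_le_of_lt h1 hδ

/-- The points at finite distance from `x` form a clopen set, and `M` is connected for the Kobayashi
topology because this is the Euclidean one. -/
lemma IsBddConnSubmanifold.edist_ne_top (hM : IsBddConnSubmanifold M) (x y : KobayashiSpace M) :
    edist x y ≠ ⊤ := by
  have hconn : PreconnectedSpace (KobayashiSpace M) := by
    refine ⟨hM.isEmbedding_val.isInducing.isPreconnected_image.1 ?_⟩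
    rw [image_univ, KobayashiSpace.range_val]
    exact hM.connected.isPreconnected
  have hclopen : IsClopen (Metric.eball x ⊤) := ⟨Metric.isClosed_eball_top, Metric.isOpen_eball⟩
  have h := hclopen.eq_univ ⟨x, by simp⟩
  have hy : y ∈ Metric.eball x ⊤ := h ▸ mem_univ y
  rw [edist_comm]
  exact ne_of_lt hy

/-- The metric space structure of `(M, k_M)`, for a bounded connected submanifold. -/
noncomputable abbrev IsBddConnSubmanifold.metricSpace (hM : IsBddConnSubmanifold M) :
    MetricSpace (KobayashiSpace M) where
  __ := PseudoEMetricSpace.toPseudoMetricSpace hM.edist_ne_top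
  eq_of_dist_eq_zero := by
    intro x y hxy
    have hxy' : edist x y = 0 := by
      have : (edist x y).toReal = 0 := hxy
      rwa [ENNReal.toReal_eq_zero_iff, or_iff_left (hM.edist_ne_top x y)] at this
    obtain ⟨C, hC⟩ := hM.exists_lipschitzWith
    have := hC x y
    rw [hxy', mul_zero, nonpos_iff_eq_zero, edist_eq_zero] at this
    exact KobayashiSpace.val_injective this

/-- A chain of length less than `a + b` exists by definition of the infimum; it is cut at length
`a`. -/
lemma IsBddConnSubmanifold.isLengthMetric (hM : IsBddConnSubmanifold M) :
    letI := hM.metricSpace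
    IsLengthMetric (KobayashiSpace M) := by
  let := hM.metricSpace
  intro x y a b ha hb hab
  have h1 : kobayashiEDist M x.val y.val < ENNReal.ofReal (a + b) := by
    change edist x y < _
    rwa [edist_dist, ENNReal.ofReal_lt_ofReal_iff_of_nonneg dist_nonneg]
  obtain ⟨r, hr, hrab⟩ := sInf_lt_iff.1 h1
  rw [ENNReal.ofReal_add ha hb] at hrab
  obtain ⟨z, hz, hxz, hzy⟩ := KobayashiChain.exists_between hr _ _ hrab.le
  refine ⟨⟨z, hz⟩, ?_, ?_⟩
  · rw [← ENNReal.ofReal_le_ofReal_iff ha, ← edist_dist]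
    exact hxz
  · rw [← ENNReal.ofReal_le_ofReal_iff hb, ← edist_dist]
    exact hzy

lemma IsBddConnSubmanifold.locallyCompactSpace (hM : IsBddConnSubmanifold M) :
    LocallyCompactSpace (KobayashiSpace M) := by
  refine hM.isEmbedding_val.isInducing.locallyCompactSpace ?_
  rw [KobayashiSpace.range_val]
  exact hM.embedded.isLocallyClosed

end

/-! ### Isometric images and the main theorem -/

lemma Isometry.isGeodesicSegment {X Y : Type*} [PseudoEMetricSpace X] [PseudoEMetricSpace Y]
    {f : X → Y} (hf : Isometry f) {γ : ℝ → X} {L : ℝ} (h : IsGeodesicSegment γ L) :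
    IsGeodesicSegment (fun t => f (γ t)) L :=
  ⟨h.1, fun s hs t ht => by rw [hf.edist_eq, h.2 s hs t ht]⟩

section

variable {m n : ℕ} {M : Set (CSpace m)} {N : Set (CSpace n)}

lemma IsBddConnSubmanifold.properSpace (hM : IsBddConnSubmanifold M)
    [hc : CompleteSpace (KobayashiSpace M)] :
    let := hM.metricSpace
    ProperSpace (KobayashiSpace M) := by
  let := hM.metricSpace
  have := hM.locallyCompactSpace
  exact hM.isLengthMetric.properSpace

lemma IsBddConnSubmanifold.exists_isGeodesicSegment (hM : IsBddConnSubmanifold M)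
    [hc : CompleteSpace (KobayashiSpace M)] (x y : KobayashiSpace M) :
    ∃ (L : ℝ) (γ : ℝ → KobayashiSpace M), IsGeodesicSegment γ L ∧ γ 0 = x ∧ γ L = y := by
  let := hM.metricSpace
  have := hM.properSpace
  exact hM.isLengthMetric.exists_isGeodesicSegment x y

/-- Completeness and geodesics are both transported from `M` by `f`; completeness of `N` is not
needed. -/
lemma Isometry.isGeodesicSubspace_range (hM : IsBddConnSubmanifold M)
    [hc : CompleteSpace (KobayashiSpace M)] {f : KobayashiSpace M → KobayashiSpace N}
    (hf : Isometry f) : IsGeodesicSubspace (range f) := by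
  refine ⟨hf.isUniformInducing.isComplete_range, ?_⟩
  rintro _ ⟨x, rfl⟩ _ ⟨y, rfl⟩ -
  obtain ⟨L, γ, hγ, h0, hL⟩ := hM.exists_isGeodesicSegment x y
  exact ⟨L, fun t => f (γ t), hf.isGeodesicSegment hγ, congrArg f h0, congrArg f hL,
    fun t _ => mem_range_self _⟩

lemma euclSet_range (f : KobayashiSpace M → KobayashiSpace N) :
    euclSet (range f) = range fun x => (f x).val :=
  (range_comp _ _).symm

/-- The visibility condition is pulled back to `M`: `f` maps geodesics of `M` to geodesics lying in
`S`, and the preimage of `K` is compact because `K` lies in the image of an embedding. -/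
lemma IsVisibilitySubspace.isVisibleEmbedding (hM : IsBddConnSubmanifold M)
    (hN : IsBddConnSubmanifold N) {f : KobayashiSpace M → KobayashiSpace N}
    (hf : Isometry f) (hS : IsVisibilitySubspace (range f)) :
    let := hM.metricSpace
    IsVisibleEmbedding fun x => (f x).val := by
  let := hM.metricSpace
  have hfe : IsEmbedding f := ⟨hf.isUniformInducing.isInducing, hf.injective⟩
  have hemb : IsEmbedding fun x => (f x).val := hN.isEmbedding_val.comp hfe
  refine ⟨hemb, ?_, ?_⟩
  · refine (hN.bounded.subset ?_).isCompact_closure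
    rintro _ ⟨x, rfl⟩
    exact (f x).mem
  · intro p hp q hq hpq
    rw [← euclSet_range] at hp hq
    obtain ⟨U, hU, V, hV, K, hK, hKS, -, h⟩ := hS.2 p hp q hq hpq
    refine ⟨U, hU, V, hV, (fun x => (f x).val) ⁻¹' K, ?_, fun L γ hγ h0 hL => ?_⟩
    · rw [euclSet_range] at hKS
      exact (hemb.isInducing.isCompact_preimage_iff hKS).2 hK
    · exact h L (fun t => f (γ t)) (hf.isGeodesicSegment hγ) (fun t _ => mem_range_self _) h0 hL

end

theorem mainTheorem2 {m n : ℕ} (M : Set (CSpace m)) (N : Set (CSpace n))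
    (hM : IsBddConnSubmanifold M) (hN : IsBddConnSubmanifold N)
    (hMcomplete : CompleteSpace (KobayashiSpace M))
    (hMhyp : IsGromovHyperbolic (KobayashiSpace M))
    (f : KobayashiSpace M → KobayashiSpace N) (hf : Isometry f) :
    IsGeodesicSubspace (range f) ∧
      (IsVisibilitySubspace (range f) →
        ∀ o : KobayashiSpace M, ∃ F : GromovCompactification o → closure N,
          Continuous F ∧ (∀ x : KobayashiSpace M, (F (.point x) : CSpace n) = (f x).val) ∧
            ((¬ ∃ γ : ℝ → KobayashiSpace N, IsGeodesicLoop (range f) γ) →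
              ∃ h : GromovCompactification o ≃ₜ closure (euclSet (range f)),
                ∀ ξ, (h ξ : CSpace n) = (F ξ : CSpace n))) := by
  refine ⟨hf.isGeodesicSubspace_range hM, fun hS o => ?_⟩
  let := hM.metricSpace
  have := hM.properSpace
  have hgeo := hM.exists_isGeodesicSegment
  have hg := hS.isVisibleEmbedding hM hN hf
  obtain ⟨F, hF⟩ := hg.exists_isRadialExtension hgeo o
  have hcont := hF.continuous hg hgeo
  have hFN : ∀ ξ, F ξ ∈ closure N := fun ξ => by
    refine closure_mono ?_ (hF.mem_closure hgeo ξ)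
    rintro _ ⟨x, rfl⟩
    exact (f x).mem
  refine ⟨codRestrict F _ hFN, hcont.codRestrict hFN, fun x => hF.apply_point hgeo x,
    fun hloop => ?_⟩
  have hinj : Function.Injective F := by
    refine hF.injective hg hMhyp hgeo ?_
    rintro ⟨σ, hσ, hlim⟩
    exact hloop ⟨fun t => f (σ t), hf.comp hσ, fun t => mem_range_self _, hlim⟩
  have hrange : range F = closure (euclSet (range f)) := by
    rw [hF.range_eq hg hgeo, euclSet_range]
  have hFS : ∀ ξ, F ξ ∈ closure (euclSet (range f)) := fun ξ => hrange ▸ mem_range_self ξ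
  have hbij : Function.Bijective (codRestrict F _ hFS) := by
    refine ⟨hinj.codRestrict hFS, fun y => ?_⟩
    obtain ⟨ξ, hξ⟩ := hrange.superset y.2
    exact ⟨ξ, Subtype.ext hξ⟩
  exact ⟨(Equiv.ofBijective _ hbij).toHomeomorphOfContinuousClosed (hcont.codRestrict hFS)
    ((hF.isClosedMap hg hgeo).codRestrict hFS), fun ξ => rfl⟩
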